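/- Let $(E,\mathcal E)$ be a non-empty measurable space whose $\sigma$-algebra $\mathcal E$ is countably generated, and let $Q$ be a bounded positive kernel on $(E,\mathcal E)$: $Q(\cdot,A)$ is measurable for every $A\in\mathcal E$, $Q(x,\cdot)$ is a positive measure for every $x\in E$, and $\sup_{x\in E}Q(x,E)<+\infty$. Bounded positive kernels $K$ act as bounded operators $Kf(x)=\int_E f(y)\,K(x,dy)$ on the Banach space $\mathcal B$ of bounded measurable functions $f:E\to\mathbb C$ with the supremum norm; $\|\cdot\|$ and $r(\cdot)$ denote the operator norm and the spectral radius on $\mathcal B$, and $Q^\ell$ is the $\ell$-th iterate of $Q$. The essential spectral radius $r_e(Q)$ is the infimum of $r(Q)$ and of the real numbers $\rho\ge 0$ for which $\mathcal B=F\oplus H$ with $F,H$ subspaces invariant under $Q$, $H$ closed, $r(Q|_H)<\rho$, $\dim F<+\infty$, and all eigenvalues of $Q|_F$ of modulus $\ge\rho$. Let $\mathcal P$ be the set of probability measures on $(E,\mathcal E)$. For $\nu\in\mathcal P$ and a bounded positive kernel $K$ put $$\Delta_\nu(K)=\limsup_{A\in\mathcal E,\ \nu(A)\to 0}\ \sup_{x\in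 E}K(x,A)=\inf_{\eta>0}\ \sup\{K(x,A): x\in E,\ A\in\mathcal E,\ \nu(A)\le\eta\}.$$ Let $\mathcal H_\nu$ be the set of measurable functions $\alpha:E\times E\to[0,+\infty)$ with $$\lim_{m\to+\infty}\ \sup_{x\in E}\int_{\{y:\,\alpha(x,y)\ge m\}}\alpha(x,y)\,d\nu(y)=0,$$ for $\alpha\in\mathcal H_\nu$ let $T_{\nu,\alpha}(x,A)=\int_A\alpha(x,y)\,d\nu(y)$, and let $\mathcal K^*=\{T_{\nu,\alpha}:\nu\in\mathcal P,\ \alpha\in\mathcal H_\nu\}$. For $T\in\mathcal K^*$, $Q^\ell-T\ge 0$ means $T(x,A)\le Q^\ell(x,A)$ for all $x\in E$, $A\in\mathcal E$. Then: (i) $\displaystyle r_e(Q)=\inf_{\ell\ge 1,\ \nu\in\mathcal P}\Delta_\nu(Q^\ell)^{1/\ell}$; (ii) $\displaystyle r_e(Q)=\inf\{\|Q^\ell-T\|^{1/\ell}:\ \ell\ge 1,\ T\in\mathcal K^*,\ Q^\ell-T\ge 0\}=\inf\{r(Q^\ell-T)^{1/\ell}:\ \ell\ge 1,\ T\in\mathcal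 K^*,\ Q^\ell-T\ge 0\}.$ -/

import Mathlib

open MeasureTheory ProbabilityTheory Filter Topology
open scoped ENNReal NNReal

noncomputable section

namespace KernelQC

/-! ### Essential spectral radius of a bounded operator -/

section Abstract

variable {B : Type*} [NormedAddCommGroup B] [NormedSpace ℂ B]

/-- The spectral radius as a real number; it is finite for bounded operators on a Banach space. -/
def specRadius (T : B →L[ℂ] B) : ℝ := (spectralRadius ℂ T).toReal

/-- `B = F ⊕ H` with `F`, `H` invariant under `T`, `H` closed with `r(T|_H) < ρ`, and `F`
finite-dimensional such that every eigenvalue of `T|_F` has modulus at least `ρ`. -/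
def HasSplitting (T : B →L[ℂ] B) (ρ : ℝ) : Prop :=
  ∃ (F H : Submodule ℂ B) (hF : ∀ v ∈ F, T v ∈ F) (hH : ∀ v ∈ H, T v ∈ H),
    IsCompl F H ∧ IsClosed (H : Set B) ∧ specRadius (T.restrict hH) < ρ ∧
    FiniteDimensional ℂ F ∧
    ∀ z : ℂ, Module.End.HasEigenvalue ((T : B →ₗ[ℂ] B).restrict hF) z → ρ ≤ ‖z‖

/-- The essential spectral radius `r_e(T)`: the infimum of `r(T)` and of all `ρ ≥ 0` at which the
space splits. -/
def essSpecRadius (T : B →L[ℂ] B) : ℝ :=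
  sInf ({specRadius T} ∪ {ρ : ℝ | 0 ≤ ρ ∧ HasSplitting T ρ})

end Abstract

section Space

variable (E : Type*) [MeasurableSpace E]

/-- The measurable elements of the space `ℓ^∞(E)` of all bounded functions `E → ℂ`. -/
def bddMeasSubmodule : Submodule ℂ (lp (fun _ : E => ℂ) ∞) where
  carrier := {f | Measurable (f : E → ℂ)}
  add_mem' := fun hf hg => Measurable.add hf hg
  zero_mem' := (measurable_const : Measurable fun _ : E => (0 : ℂ))
  smul_mem' := fun c _ hf => Measurable.const_smul hf c

theorem isClosed_bddMeasSubmodule :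
    IsClosed (bddMeasSubmodule E : Set (lp (fun _ : E => ℂ) ∞)) := by
  refine isClosed_of_closure_subset fun f hf => ?_
  obtain ⟨u, hu, hlim⟩ := mem_closure_iff_seq_limit.1 hf
  refine measurable_of_tendsto_metrizable (f := fun n => (u n : E → ℂ)) (fun n => hu n) ?_
  rw [tendsto_pi_nhds]
  intro x
  rw [tendsto_iff_norm_sub_tendsto_zero] at hlim ⊢
  refine squeeze_zero (fun _ => norm_nonneg _) (fun n => ?_) hlim
  simpa using lp.norm_apply_le_norm ENNReal.top_ne_zero (u n - f) x

/-- The Banach space of bounded measurable functions `E → ℂ` with the supremum norm. -/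
def BddMeas : Type _ := bddMeasSubmodule E

instance : NormedAddCommGroup (BddMeas E) :=
  inferInstanceAs (NormedAddCommGroup (bddMeasSubmodule E))

instance : NormedSpace ℂ (BddMeas E) :=
  inferInstanceAs (NormedSpace ℂ (bddMeasSubmodule E))

instance : CompleteSpace (BddMeas E) :=
  (isClosed_bddMeasSubmodule E).completeSpace_coe

instance : CoeFun (BddMeas E) (fun _ => E → ℂ) :=
  ⟨fun f => (f.1 : E → ℂ)⟩

variable {E}

theorem BddMeas.ext {f g : BddMeas E} (h : ∀ x, f x = g x) : f = g :=
  Subtype.ext (lp.ext (funext h))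

theorem BddMeas.measurable (f : BddMeas E) : Measurable (fun x => f x) := f.2

theorem BddMeas.norm_apply_le (f : BddMeas E) (x : E) : ‖f x‖ ≤ ‖f‖ :=
  lp.norm_apply_le_norm ENNReal.top_ne_zero f.1 x

theorem BddMeas.norm_eq_iSup (f : BddMeas E) : ‖f‖ = ⨆ x, ‖f x‖ :=
  lp.norm_eq_ciSup f.1

theorem BddMeas.norm_le {f : BddMeas E} {C : ℝ} (hC : 0 ≤ C) (h : ∀ x, ‖f x‖ ≤ C) : ‖f‖ ≤ C :=
  lp.norm_le_of_forall_le (f := f.1) hC h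

end Space

/-! ### Kernels

A bounded positive kernel on `E` is a `Q : Kernel E E` with `[IsFiniteKernel Q]`; iterated kernels
are the powers `Q ^ ℓ` in the monoid `Kernel E E`, whose product is composition. -/

section Kernels

variable {E : Type*} [MeasurableSpace E]

theorem norm_integral_kernel_le (Q : Kernel E E) [IsFiniteKernel Q] (f : BddMeas E) (x : E) :
    ‖∫ y, f y ∂(Q x)‖ ≤ Q.bound.toReal * ‖f‖ := by
  refine (norm_integral_le_of_norm_le_const (C := ‖f‖)
    (ae_of_all _ fun y => f.norm_apply_le y)).trans ?_
  rw [mul_comm]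
  refine mul_le_mul_of_nonneg_right ?_ (norm_nonneg _)
  exact ENNReal.toReal_mono (Kernel.bound_ne_top _) (Kernel.measure_le_bound _ _ _)

theorem integrable_bddMeas (μ : Measure E) [IsFiniteMeasure μ] (f : BddMeas E) :
    Integrable (fun y => f y) μ :=
  Integrable.of_bound f.measurable.aestronglyMeasurable ‖f‖
    (ae_of_all _ fun y => f.norm_apply_le y)

/-- The function `Qf`, `Qf(x) = ∫ f(y) Q(x, dy)`, for a bounded measurable `f`. -/
def kernelFun (Q : Kernel E E) [IsFiniteKernel Q] (f : BddMeas E) : BddMeas E :=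
  ⟨⟨fun x => ∫ y, f y ∂(Q x),
    memℓp_infty ⟨Q.bound.toReal * ‖f‖, by
      rintro _ ⟨x, rfl⟩
      exact norm_integral_kernel_le Q f x⟩⟩,
    (StronglyMeasurable.integral_kernel (κ := Q) f.measurable.stronglyMeasurable).measurable⟩

/-- The bounded operator `f ↦ Qf` on the space of bounded measurable functions. -/
def kernelOp (Q : Kernel E E) [IsFiniteKernel Q] : BddMeas E →L[ℂ] BddMeas E :=
  LinearMap.mkContinuous
    { toFun := kernelFun Q
      map_add' := fun f g => BddMeas.ext fun x =>
        integral_add (integrable_bddMeas (Q x) f) (integrable_bddMeas (Q x) g)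
      map_smul' := fun c f => BddMeas.ext fun x => integral_const_mul c (fun y => f y) }
    Q.bound.toReal
    (fun f => BddMeas.norm_le (by positivity) fun x => norm_integral_kernel_le Q f x)

theorem kernelOp_apply (Q : Kernel E E) [IsFiniteKernel Q] (f : BddMeas E) (x : E) :
    kernelOp Q f x = ∫ y, f y ∂(Q x) := rfl

instance isFiniteKernel_pow (Q : Kernel E E) [IsFiniteKernel Q] (n : ℕ) :
    IsFiniteKernel (Q ^ n) := by
  induction n with
  | zero => exact inferInstanceAs (IsFiniteKernel (Kernel.id : Kernel E E))
  | succ n ih =>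
    rw [pow_succ]
    exact inferInstanceAs (IsFiniteKernel ((Q ^ n) ∘ₖ Q))

/-- The operator of an iterated kernel is the corresponding power of the operator. -/
theorem kernelOp_pow (Q : Kernel E E) [IsFiniteKernel Q] (n : ℕ) :
    kernelOp (Q ^ n) = kernelOp Q ^ n := by
  induction n with
  | zero =>
    refine ContinuousLinearMap.ext fun f => BddMeas.ext fun x => ?_
    rw [kernelOp_apply]
    exact integral_dirac' _ _ f.measurable.stronglyMeasurable
  | succ n ih =>
    refine ContinuousLinearMap.ext fun f => BddMeas.ext fun x => ?_
    rw [pow_succ' (kernelOp Q), ← ih]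
    exact (congrArg (fun κ : Kernel E E => ∫ y, f y ∂(κ x)) (pow_succ Q n)).trans
      (Kernel.integral_comp (integrable_bddMeas (((Q ^ n) ∘ₖ Q) x) f))

/-- `Δ_ν(Q) = limsup_{ν(A) → 0} sup_x Q(x, A)`, the upper limit being over measurable sets `A`;
it is a finite number when `Q` is a bounded kernel. -/
def doeblin (ν : Measure E) (Q : Kernel E E) : ℝ≥0∞ :=
  limsup (fun A : {A : Set E // MeasurableSet A} => ⨆ x, Q x A)
    (comap (fun A : {A : Set E // MeasurableSet A} => ν A) (𝓝 0))

/-- `α` is a nonnegative measurable function on `E × E` such that the functions `α(x, ·)`, `x ∈ E`,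
are uniformly `ν`-integrable:
`lim_{m → ∞} sup_x ∫_{α(x, y) ≥ m} α(x, y) dν(y) = 0`. -/
def UnifIntDensity (ν : Measure E) (α : E × E → ℝ≥0) : Prop :=
  Measurable α ∧
    Tendsto (fun m : ℕ => ⨆ x, ∫⁻ y in {y | (m : ℝ≥0) ≤ α (x, y)}, (α (x, y) : ℝ≥0∞) ∂ν)
      atTop (𝓝 0)

/-- The class `𝒦*` of the kernels `T(x, A) = ∫_A α(x, y) dν(y)`, where `ν` is a probability measure
and `α` is uniformly `ν`-integrable. -/
def UnifAC (T : Kernel E E) : Prop :=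
  ∃ (ν : Measure E) (α : E × E → ℝ≥0), IsProbabilityMeasure ν ∧ UnifIntDensity ν α ∧
    ∀ x, ∀ A, MeasurableSet A → T x A = ∫⁻ y in A, (α (x, y) : ℝ≥0∞) ∂ν

/-- Kernels of the class `𝒦*` are bounded. -/
theorem UnifAC.isFiniteKernel {T : Kernel E E} (hT : UnifAC T) : IsFiniteKernel T := by
  obtain ⟨ν, α, hν, ⟨hα, hlim⟩, h⟩ := hT
  obtain ⟨m, hm⟩ := (hlim.eventually (gt_mem_nhds (zero_lt_one (α := ℝ≥0∞)))).exists
  refine ⟨⟨1 + m, by simp, fun x => ?_⟩⟩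
  have hs : MeasurableSet {y | (m : ℝ≥0) ≤ α (x, y)} :=
    measurableSet_le measurable_const (hα.comp measurable_prodMk_left)
  rw [h x _ MeasurableSet.univ, Measure.restrict_univ, ← lintegral_add_compl _ hs]
  refine add_le_add ((le_iSup (fun x => ∫⁻ y in {y | (m : ℝ≥0) ≤ α (x, y)},
    (α (x, y) : ℝ≥0∞) ∂ν) x).trans hm.le) ?_
  calc ∫⁻ y in {y | (m : ℝ≥0) ≤ α (x, y)}ᶜ, (α (x, y) : ℝ≥0∞) ∂ν
      ≤ ∫⁻ _ in {y | (m : ℝ≥0) ≤ α (x, y)}ᶜ, (m : ℝ≥0∞) ∂ν := by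
        refine setLIntegral_mono measurable_const fun y hy => ?_
        have hy' : α (x, y) ≤ (m : ℝ≥0) := (lt_of_not_ge fun hle => hy hle).le
        exact_mod_cast hy'
    _ ≤ m := by
        rw [setLIntegral_const]
        exact mul_le_of_le_one_right' prob_le_one

/-- `Q - T ≥ 0`, that is `T(x, A) ≤ Q(x, A)` for all `x` and all measurable `A`. -/
def KernelLE (T Q : Kernel E E) : Prop := ∀ x, ∀ A, MeasurableSet A → T x A ≤ Q x A

end Kernels

end KernelQC

end

/-! Four quantities are compared in a circle. With infima over the admissible `ℓ`, `T`, `ν`: r_e(Q)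
≤ inf r(Q^ℓ - T)^(1/ℓ) ≤ inf ‖Q^ℓ - T‖^(1/ℓ) ≤ inf Δ_ν(Q^ℓ)^(1/ℓ) ≤ r_e(Q). The second inequality is
r ≤ ‖·‖.

First inequality (`essSpecRadius_le_specRadius_sub`): truncation makes the density of T bounded at a
small cost in norm. Write Q^ℓ = R + T. Since R is positive, R^i is dominated by Q^(ℓi), so T R^i is
dominated by one finite measure that does not depend on the point. Hence T R^i T is compact,
although T alone need not be: the density of the last factor is approximated by rectangles in L¹ of
a product measure. In (R + T)^n every word with at least two letters T is then compact, and the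
other words add up to O(n q^n) with q slightly above r(R). So if r(R) < ρ^ℓ, some power of Q is
close to a compact operator. A Riesz-type argument (`hasSplitting_of_norm_pow_sub_le`) then splits
the space at ρ: F is a maximal finite-dimensional invariant subspace whose eigenvalues all have
modulus at least ρ, and the invariant projection onto F is the limit of A^(-k) p Q^k, with A = Q|_F
and p any bounded projection onto F.

Third inequality (`exists_unifAC_of_doeblin_lt`): T is the truncated absolutely continuous part of
Q^ℓ. What it misses lives on a set of small ν-measure, where Δ_ν bounds the mass of Q^ℓ. Countable
generation of the σ-algebra supplies the jointly measurable density.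

Last inequality (`exists_doeblin_lt_of_hasSplitting`): given a splitting at ρ, the H-part of Q^ℓ 1_A
is O(q^ℓ) with q < ρ, and the F-part is controlled by its values at finitely many points y. So
Q^ℓ(x, A) ≤ C ∑ Q^ℓ(y, A) + D q^ℓ with C, D independent of ℓ, and ν is built from ∑ Q^ℓ(y, ·). -/

noncomputable section

namespace KernelQC

/-! ### Spectral radius, growth of powers, and eigenvalues near compact operators -/

section SpectralRadius

variable {X : Type*} [NormedAddCommGroup X] [NormedSpace ℂ X]

theorem specRadius_nonneg (T : X →L[ℂ] X) : 0 ≤ specRadius T := ENNReal.toReal_nonneg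

theorem specRadius_le_of_forall_mem_spectrum {T : X →L[ℂ] X} {q : ℝ} (hq : 0 ≤ q)
    (h : ∀ z ∈ spectrum ℂ T, ‖z‖ ≤ q) : specRadius T ≤ q := by
  refine ENNReal.toReal_le_of_le_ofReal hq (iSup₂_le fun z hz => ?_)
  rw [ENNReal.le_ofReal_iff_toReal_le ENNReal.coe_ne_top hq]
  exact h z hz

variable [CompleteSpace X]

theorem spectralRadius_ne_top (T : X →L[ℂ] X) : spectralRadius ℂ T ≠ ⊤ := by
  have h := spectrum.spectralRadius_le_pow_nnnorm_pow_one_div ℂ T 0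
  refine ne_top_of_le_ne_top ?_ h
  simpa using ENNReal.mul_ne_top ENNReal.coe_ne_top ENNReal.coe_ne_top

theorem tendsto_norm_pow_specRadius (T : X →L[ℂ] X) :
    Tendsto (fun n : ℕ => ‖T ^ n‖ ^ (1 / n : ℝ)) atTop (𝓝 (specRadius T)) := by
  have h := (ENNReal.tendsto_toReal (spectralRadius_ne_top T)).comp
    (spectrum.pow_norm_pow_one_div_tendsto_nhds_spectralRadius T)
  refine h.congr fun n => ?_
  simp only [Function.comp]
  exact ENNReal.toReal_ofReal (by positivity)

theorem eventually_norm_pow_le {T : X →L[ℂ] X} {q : ℝ} (h : specRadius T < q) :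
    ∀ᶠ n : ℕ in atTop, ‖T ^ n‖ ≤ q ^ n := by
  filter_upwards [(tendsto_norm_pow_specRadius T).eventually (gt_mem_nhds h),
    eventually_ge_atTop 1] with n hn h1
  have hq : 0 ≤ q := (specRadius_nonneg T).trans h.le
  rw [one_div] at hn
  have := Real.rpow_inv_natCast_pow (norm_nonneg (T ^ n)) (n := n) (by omega)
  rw [← this]
  gcongr

theorem exists_norm_pow_le {T : X →L[ℂ] X} {q : ℝ} (h : specRadius T < q) :
    ∃ C : ℝ, 0 < C ∧ ∀ n : ℕ, ‖T ^ n‖ ≤ C * q ^ n := by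
  have hq : 0 < q := (specRadius_nonneg T).trans_lt h
  obtain ⟨N, hN⟩ := eventually_atTop.1 (eventually_norm_pow_le h)
  refine ⟨1 + ∑ i ∈ Finset.range N, ‖T ^ i‖ / q ^ i, by positivity, fun n => ?_⟩
  rcases le_or_gt N n with hn | hn
  · refine (hN n hn).trans (le_mul_of_one_le_left (by positivity) ?_)
    have : 0 ≤ ∑ i ∈ Finset.range N, ‖T ^ i‖ / q ^ i := by positivity
    linarith
  · rw [← div_le_iff₀ (by positivity)]
    have := Finset.single_le_sum (f := fun i => ‖T ^ i‖ / q ^ i) (fun i _ => by positivity)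
      (Finset.mem_range.2 hn)
    linarith

theorem specRadius_le_of_norm_pow_le {T : X →L[ℂ] X} {q C : ℝ} (hq : 0 ≤ q)
    (h : ∀ n : ℕ, ‖T ^ n‖ ≤ C * q ^ n) : specRadius T ≤ q := by
  have hC : 0 < |C| + 1 := by positivity
  have h1 : Tendsto (fun n : ℕ => (|C| + 1) ^ (1 / n : ℝ) * q) atTop (𝓝 ((|C| + 1) ^ (0 : ℝ) * q)) := by
    refine Tendsto.mul_const _ ?_
    exact (Real.continuousAt_const_rpow hC.ne').tendsto.comp tendsto_one_div_atTop_nhds_zero_nat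
  rw [Real.rpow_zero, one_mul] at h1
  refine le_of_tendsto_of_tendsto (tendsto_norm_pow_specRadius T) h1 ?_
  filter_upwards [eventually_ge_atTop 1] with n hn
  have h2 : ‖T ^ n‖ ≤ (|C| + 1) * q ^ n :=
    (h n).trans (by gcongr; linarith [le_abs_self C])
  calc ‖T ^ n‖ ^ (1 / n : ℝ) ≤ ((|C| + 1) * q ^ n) ^ (1 / n : ℝ) := by gcongr
    _ = _ := by
      rw [Real.mul_rpow hC.le (by positivity), one_div, Real.pow_rpow_inv_natCast hq (by omega)]

theorem specRadius_le_norm (T : X →L[ℂ] X) : specRadius T ≤ ‖T‖ := by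
  refine specRadius_le_of_norm_pow_le (C := 1) (norm_nonneg T) fun n => ?_
  rw [one_mul]
  rcases Nat.eq_zero_or_pos n with rfl | hn
  · rw [pow_zero, pow_zero]
    exact ContinuousLinearMap.norm_id_le
  · exact norm_pow_le' T hn

/-- A condition on a single power is open in the operator, so this gives the upper semicontinuity of
the spectral radius needed when a density is truncated. -/
theorem specRadius_lt_of_norm_pow_lt {T : X →L[ℂ] X} {q : ℝ} (hq : 0 < q) {n : ℕ} (hn : n ≠ 0)
    (h : ‖T ^ n‖ < q ^ n) : specRadius T < q := by
  have h1 : spectralRadius ℂ T ^ n ≤ spectralRadius ℂ (T ^ n) := spectrum.spectralRadius_pow_le T n hn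
  have h2 : specRadius T ^ n ≤ specRadius (T ^ n) := by
    rw [specRadius, specRadius, ← ENNReal.toReal_pow]
    exact ENNReal.toReal_mono (spectralRadius_ne_top _) h1
  exact lt_of_pow_lt_pow_left₀ n hq.le (h2.trans_lt ((specRadius_le_norm _).trans_lt h))

/-- The spectrum is compact, so the largest modulus is attained and strictness survives. The
spectrum is empty only for the trivial space, hence the separate case. -/
theorem specRadius_lt_of_forall_mem_spectrum {T : X →L[ℂ] X} {q : ℝ} (hq : 0 < q)
    (h : ∀ z ∈ spectrum ℂ T, ‖z‖ < q) : specRadius T < q := by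
  rcases (spectrum ℂ T).eq_empty_or_nonempty with he | hne
  · exact (specRadius_le_of_forall_mem_spectrum le_rfl (by simp [he])).trans_lt hq
  · obtain ⟨z, hz, hmax⟩ := (spectrum.isCompact (𝕜 := ℂ) T).exists_isMaxOn hne continuous_norm.continuousOn
    exact (specRadius_le_of_forall_mem_spectrum (norm_nonneg z) fun w hw => hmax hw).trans_lt (h z hz)

/-- A point of the spectrum which is larger than the distance to a compact operator is an
eigenvalue. -/
theorem exists_eigenvector_of_mem_spectrum {S K : X →L[ℂ] X} (hK : IsCompactOperator K) {w : ℂ}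
    (hw : ‖S - K‖ < ‖w‖) (hmem : w ∈ spectrum ℂ S) : ∃ v : X, v ≠ 0 ∧ S v = w • v := by
  have hres : w ∈ resolventSet ℂ (S - K) := by
    refine spectrum.mem_resolventSet_of_norm_lt_mul (lt_of_le_of_lt ?_ hw)
    exact mul_le_of_le_one_right (norm_nonneg _) ContinuousLinearMap.norm_id_le
  rw [spectrum.mem_resolventSet_iff] at hres
  obtain ⟨U, hU⟩ := hres
  have hcomp : IsCompactOperator ((↑U⁻¹ : X →L[ℂ] X) * K) := hK.clm_comp _
  -- Here U = w - (S - K) is invertible, so the Fredholm alternative at 1 for the compact operator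
  -- U⁻¹K decides between an eigenvector of S and invertibility of w - S.
  have hfac : algebraMap ℂ (X →L[ℂ] X) w - S = U * (1 - (↑U⁻¹ : X →L[ℂ] X) * K) := by
    rw [mul_sub, ← mul_assoc, Units.mul_inv, hU]
    noncomm_ring
  rcases hcomp.hasEigenvalue_or_mem_resolventSet (one_ne_zero (α := ℂ)) with h | h
  · obtain ⟨v, hv⟩ := h.exists_hasEigenvector
    refine ⟨v, hv.2, ?_⟩
    have h1 : (↑U⁻¹ : X →L[ℂ] X) (K v) = v := by simpa using hv.apply_eq_smul
    have h2 := congrArg (fun Φ : X →L[ℂ] X => Φ v) hfac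
    simp only [sub_apply, mul_apply_eq_comp,
      one_apply_eq_self, h1, sub_self, map_zero,
      ContinuousLinearMap.algebraMap_apply] at h2
    exact (sub_eq_zero.1 h2).symm
  · exfalso
    rw [spectrum.mem_resolventSet_iff, map_one] at h
    rw [spectrum.mem_iff, hfac] at hmem
    exact hmem (U.isUnit.mul h)

end SpectralRadius

/-- If a power of a linear map has the eigenvalue `w`, then the map has an eigenvalue which is a
root of `w`. -/
theorem exists_eigenvector_of_pow {V : Type*} [AddCommGroup V] [Module ℂ V] (S : Module.End ℂ V)
    {n : ℕ} (hn : 0 < n) {w : ℂ} {v : V} (hv : v ≠ 0) (h : (S ^ n) v = w • v) :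
    ∃ (z : ℂ) (u : V), z ^ n = w ∧ u ≠ 0 ∧ S u = z • u := by
  set p : Polynomial ℂ := Polynomial.X ^ n - Polynomial.C w with hp
  have hmonic : p.Monic := Polynomial.monic_X_pow_sub_C w hn.ne'
  have hprod : (p.roots.map fun a => Polynomial.X - Polynomial.C a).prod = p := by
    refine Polynomial.prod_multiset_X_sub_C_of_monic_of_roots_card_eq hmonic ?_
    exact (IsAlgClosed.splits p).natDegree_eq_card_roots.symm
  -- If a product of factors S - a kills v ≠ 0, peel the factors off one by one: some factor kills a
  -- vector that is still nonzero.
  have key : ∀ s : Multiset ℂ,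
      Polynomial.aeval S (s.map fun a => Polynomial.X - Polynomial.C a).prod v = 0 →
      ∃ z ∈ s, ∃ u : V, u ≠ 0 ∧ S u = z • u := by
    intro s
    induction s using Multiset.induction_on with
    | empty => intro h0; exact absurd (by simpa using h0) hv
    | cons a s ih =>
      intro h0
      rw [Multiset.map_cons, Multiset.prod_cons, map_mul] at h0
      by_cases hu : Polynomial.aeval S (s.map fun a => Polynomial.X - Polynomial.C a).prod v = 0
      · obtain ⟨z, hz, u, hu⟩ := ih hu
        exact ⟨z, Multiset.mem_cons_of_mem hz, u, hu⟩
      · refine ⟨a, Multiset.mem_cons_self _ _, _, hu, ?_⟩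
        simpa [sub_eq_zero] using h0
  obtain ⟨z, hz, u, hu, hSu⟩ := key p.roots (by
    rw [hprod, hp]
    simp [h])
  refine ⟨z, u, ?_, hu, hSu⟩
  have := Polynomial.isRoot_of_mem_roots hz
  simpa [hp, sub_eq_zero] using this

/-! ### Maximal invariant subspaces with large eigenvalues -/

section Splitting

variable {X : Type*} [NormedAddCommGroup X] [NormedSpace ℂ X]

theorem mem_sup_span_singleton {F : Submodule ℂ X} {v u : X} :
    u ∈ F ⊔ ℂ ∙ v ↔ ∃ f ∈ F, ∃ c : ℂ, f + c • v = u := by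
  simp only [Submodule.mem_sup, Submodule.mem_span_singleton]
  constructor
  · rintro ⟨f, hf, _, ⟨c, rfl⟩, h⟩
    exact ⟨f, hf, c, h⟩
  · rintro ⟨f, hf, c, h⟩
    exact ⟨f, hf, _, ⟨c, rfl⟩, h⟩

/-- `F` is a finite-dimensional invariant subspace of `T` on which all eigenvalues of `T` have
modulus at least `ρ`. -/
structure IsOuterSubspace (T : X →L[ℂ] X) (ρ : ℝ) (F : Submodule ℂ X) : Prop where
  finiteDimensional : FiniteDimensional ℂ F
  map_mem : ∀ v ∈ F, T v ∈ F
  le_norm : ∀ u ∈ F, ∀ z : ℂ, u ≠ 0 → T u = z • u → ρ ≤ ‖z‖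

theorem isOuterSubspace_bot (T : X →L[ℂ] X) (ρ : ℝ) : IsOuterSubspace T ρ ⊥ where
  finiteDimensional := inferInstance
  map_mem := by simp
  le_norm := fun u hu _ h0 => absurd ((Submodule.mem_bot ℂ).1 hu) h0

/-- Modulo F the new vector is an eigenvector for z, so z is the only eigenvalue that can be added.
-/
theorem IsOuterSubspace.sup_span {T : X →L[ℂ] X} {ρ : ℝ} {F : Submodule ℂ X}
    (hF : IsOuterSubspace T ρ F) {v : X} {z : ℂ} (hz : ρ ≤ ‖z‖) (hv : v ∉ F)
    (h : T v - z • v ∈ F) : IsOuterSubspace T ρ (F ⊔ ℂ ∙ v) where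
  finiteDimensional := by
    have := hF.finiteDimensional
    infer_instance
  map_mem := by
    intro u hu
    obtain ⟨f, hf, c, rfl⟩ := mem_sup_span_singleton.1 hu
    have h1 : T (f + c • v) = (T f + c • (T v - z • v)) + (c * z) • v := by
      rw [map_add, map_smul]; module
    rw [h1]
    exact mem_sup_span_singleton.2
      ⟨_, F.add_mem (hF.map_mem f hf) (F.smul_mem c h), c * z, rfl⟩
  le_norm := by
    intro u hu w hu0 hw
    obtain ⟨f, hf, c, rfl⟩ := mem_sup_span_singleton.1 hu
    by_cases hc : c = 0
    · subst hc
      rw [zero_smul, add_zero] at hu0 hw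
      exact hF.le_norm f hf w hu0 hw
    · have h1 : (c * (w - z)) • v = T f - w • f + c • (T v - z • v) := by
        rw [map_add, map_smul] at hw
        linear_combination (norm := module) (-1 : ℂ) • hw
      have h2 : (c * (w - z)) • v ∈ F := by
        rw [h1]
        exact F.add_mem (F.sub_mem (hF.map_mem f hf) (F.smul_mem w hf)) (F.smul_mem c h)
      have h3 : c * (w - z) = 0 := by
        by_contra hne
        exact hv ((F.smul_mem_iff hne).1 h2)
      have h4 : w = z := by
        simpa [hc, sub_eq_zero] using h3
      rwa [h4]

/-- T acts on G modulo F as the scalar z, hence its N-th power acts as z^N. -/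
theorem pow_sub_smul_mem_of_chain {T : X →L[ℂ] X} {F G : Submodule ℂ X} {z : ℂ}
    (h : ∀ v ∈ G, T v - z • v ∈ F) {v : X} (hv : v ∈ G)
    (hG : ∀ v ∈ G, T v ∈ G) (N : ℕ) : (T ^ N) v - z ^ N • v ∈ F := by
  induction N with
  | zero => simp
  | succ N ih =>
    have hmem : (T ^ N) v ∈ G := by
      clear ih
      induction N with
      | zero => simpa using hv
      | succ N ih => rw [pow_succ']; exact hG _ ih
    have h1 : (T ^ (N + 1)) v - z ^ (N + 1) • v
        = (T ((T ^ N) v) - z • (T ^ N) v) + z • ((T ^ N) v - z ^ N • v) := by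
      rw [pow_succ' T, mul_apply_eq_comp]; module
    rw [h1]
    exact F.add_mem (h _ hmem) (F.smul_mem _ ih)

/-- A Riesz vector in the larger of two nested finite-dimensional subspaces. -/
theorem exists_riesz_vector {F G : Submodule ℂ X} [FiniteDimensional ℂ F]
    (h : F < G) : ∃ e ∈ G, ‖e‖ ≤ 2 ∧ ∀ y ∈ F, 1 ≤ ‖e - y‖ := by
  obtain ⟨hle, x, hx, hxF⟩ := SetLike.lt_iff_le_and_exists.1 h
  have hcl : IsClosed ((F.comap G.subtype : Submodule ℂ G) : Set G) :=
    (F.closed_of_finiteDimensional).preimage continuous_subtype_val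
  obtain ⟨e, he, hy⟩ := riesz_lemma_of_norm_lt (𝕜 := ℂ) (c := 3 / 2) (R := 2) (by norm_num)
    (by norm_num) hcl ⟨⟨x, hx⟩, hxF⟩
  exact ⟨e, e.2, he, fun y hyF => hy ⟨y, hle hyF⟩ hyF⟩

/-- If a power of `T` is close to a compact operator, there is a maximal subspace on which all
eigenvalues of `T` have modulus at least `ρ`. -/
theorem exists_maximal_isOuterSubspace {T K : X →L[ℂ] X} (hK : IsCompactOperator K) {ρ : ℝ}
    (hρ : 0 < ρ) {N : ℕ} (hN : ‖T ^ N - K‖ ≤ ρ ^ N / 8) :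
    ∃ F : Submodule ℂ X, IsOuterSubspace T ρ F ∧
      ∀ (v : X) (z : ℂ), ρ ≤ ‖z‖ → T v - z • v ∈ F → v ∈ F := by
  -- Without a maximal subspace, vectors can be adjoined forever. The resulting strictly increasing
  -- chain is refuted as in Riesz's theory, with K in place of T^N up to a small error.
  by_contra! hcon
  choose! v z hz hv hvF using hcon
  let Φ : Submodule ℂ X → Submodule ℂ X := fun F => F ⊔ ℂ ∙ v F
  let F : ℕ → Submodule ℂ X := fun n => Φ^[n] ⊥
  have hsucc : ∀ n, F (n + 1) = F n ⊔ ℂ ∙ v (F n) := fun n => Function.iterate_succ_apply' Φ n ⊥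
  have hgood : ∀ n, IsOuterSubspace T ρ (F n) := by
    intro n
    induction n with
    | zero => exact isOuterSubspace_bot T ρ
    | succ n ih =>
      rw [hsucc]
      exact ih.sup_span (hz _ ih) (hvF _ ih) (hv _ ih)
  have hlt : ∀ n, F n < F (n + 1) := by
    intro n
    rw [hsucc]
    refine SetLike.lt_iff_le_and_exists.2 ⟨le_sup_left, v (F n), ?_, hvF _ (hgood n)⟩
    exact Submodule.mem_sup_right (Submodule.mem_span_singleton_self _)
  have hmono : Monotone F := monotone_nat_of_le_succ fun n => (hlt n).le
  have hstep : ∀ n, ∀ u ∈ F (n + 1), T u - z (F n) • u ∈ F n := by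
    intro n u hu
    rw [hsucc] at hu
    obtain ⟨f, hf, c, rfl⟩ := mem_sup_span_singleton.1 hu
    have h1 : T (f + c • v (F n)) - z (F n) • (f + c • v (F n))
        = T f - z (F n) • f + c • (T (v (F n)) - z (F n) • v (F n)) := by
      rw [map_add, map_smul]; module
    rw [h1]
    exact (F n).add_mem ((F n).sub_mem ((hgood n).map_mem f hf) ((F n).smul_mem _ hf))
      ((F n).smul_mem c (hv _ (hgood n)))
  have hriesz : ∀ n, ∃ e ∈ F (n + 1), ‖e‖ ≤ 2 ∧ ∀ y ∈ F n, 1 ≤ ‖e - y‖ := fun n =>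
    have := (hgood n).finiteDimensional
    exists_riesz_vector (hlt n)
  choose e heF he2 hedist using hriesz
  have hpow : ∀ n, (T ^ N) (e n) - z (F n) ^ N • e n ∈ F n := fun n =>
    pow_sub_smul_mem_of_chain (hstep n) (heF n) (hgood (n + 1)).map_mem N
  have hR : ∀ n, ‖(T ^ N - K) (e n)‖ ≤ ρ ^ N / 4 := fun n => by
    refine ((T ^ N - K).le_opNorm _).trans ?_
    have := mul_le_mul hN (he2 n) (norm_nonneg _) (by positivity)
    linarith
  -- T^N e_n - T^N e_m equals z^N (e_n - y) with y in F n, so its norm is at least ρ^N. Replacing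
  -- T^N by K costs at most 2 · ρ^N / 8 for each of the two vectors; this is where the constant 8
  -- comes from.
  have hsep : ∀ m n, m < n → ρ ^ N / 2 ≤ ‖K (e n) - K (e m)‖ := by
    intro m n hmn
    have hw : ρ ^ N ≤ ‖z (F n) ^ N‖ := by
      rw [norm_pow]
      exact pow_le_pow_left₀ hρ.le (hz _ (hgood n)) N
    have hw0 : z (F n) ^ N ≠ 0 := by
      intro h0
      rw [h0, norm_zero] at hw
      have : 0 < ρ ^ N := by positivity
      linarith
    have hTm : (T ^ N) (e m) ∈ F n := by
      have h1 := (F (m + 1)).add_mem (hmono (Nat.le_succ m) (hpow m))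
        ((F (m + 1)).smul_mem (z (F m) ^ N) (heF m))
      rw [sub_add_cancel] at h1
      exact hmono hmn h1
    set y : X := (z (F n) ^ N)⁻¹ • ((T ^ N) (e m) - ((T ^ N) (e n) - z (F n) ^ N • e n)) with hy
    have hyF : y ∈ F n := (F n).smul_mem _ ((F n).sub_mem hTm (hpow n))
    have h1 : (T ^ N) (e n) - (T ^ N) (e m) = z (F n) ^ N • (e n - y) := by
      rw [hy, smul_sub, smul_inv_smul₀ hw0]; abel
    have h2 : ρ ^ N ≤ ‖(T ^ N) (e n) - (T ^ N) (e m)‖ := by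
      rw [h1, norm_smul]
      exact hw.trans (le_mul_of_one_le_right (norm_nonneg _) (hedist n y hyF))
    have h3 : (T ^ N) (e n) - (T ^ N) (e m)
        = (K (e n) - K (e m)) + ((T ^ N - K) (e n) - (T ^ N - K) (e m)) := by
      simp only [sub_apply]; abel
    rw [h3] at h2
    have h4 := norm_add_le (K (e n) - K (e m)) ((T ^ N - K) (e n) - (T ^ N - K) (e m))
    have h5 := norm_sub_le ((T ^ N - K) (e n)) ((T ^ N - K) (e m))
    have h6 := hR n
    have h7 := hR m
    linarith
  obtain ⟨S, hS, hS'⟩ := hK.image_closedBall_subset_compact 2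
  obtain ⟨y, -, ψ, hψ, hψy⟩ := hS.tendsto_subseq
    (x := fun n => K (e n)) (fun n => hS' ⟨e n, by simpa using he2 n, rfl⟩)
  obtain ⟨M, hM⟩ := Metric.cauchySeq_iff'.1 hψy.cauchySeq (ρ ^ N / 2) (by positivity)
  have h1 := hM (M + 1) (Nat.le_succ M)
  rw [dist_eq_norm] at h1
  exact absurd (hsep _ _ (hψ (Nat.lt_succ_self M))) (not_le.2 h1)

end Splitting

/-! ### From a maximal subspace to an invariant splitting -/

section Splitting

variable {X : Type*} [NormedAddCommGroup X] [NormedSpace ℂ X]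

/-- On an outer subspace, `T` is invertible and its inverse has spectral radius at most `ρ⁻¹`. -/
theorem IsOuterSubspace.exists_inverse {T : X →L[ℂ] X} {ρ : ℝ} (hρ : 0 < ρ) {F : Submodule ℂ X}
    (hF : IsOuterSubspace T ρ F) : ∃ J : F →L[ℂ] F, (∀ f, J (T.restrict hF.map_mem f) = f) ∧
      (∀ f, T.restrict hF.map_mem (J f) = f) ∧ specRadius J ≤ ρ⁻¹ := by
  have := hF.finiteDimensional
  have : CompleteSpace F := FiniteDimensional.complete ℂ F
  have hinj : Function.Injective (T.restrict hF.map_mem : F →ₗ[ℂ] F) := by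
    rw [← LinearMap.ker_eq_bot, LinearMap.ker_eq_bot']
    intro f hf
    by_contra h0
    have h1 : T f = (0 : ℂ) • (f : X) := by
      rw [zero_smul]; exact congrArg Subtype.val hf
    have := hF.le_norm f f.2 0 (by simpa using h0) h1
    rw [norm_zero] at this
    linarith
  let e : F ≃ₗ[ℂ] F := LinearEquiv.ofInjectiveEndo _ hinj
  have he : ∀ f, e f = T.restrict hF.map_mem f := fun f => rfl
  let J : F →L[ℂ] F := LinearMap.toContinuousLinearMap (e.symm : F →ₗ[ℂ] F)
  have hJ : ∀ f, J f = e.symm f := fun f => rfl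
  refine ⟨J, fun f => ?_, fun f => ?_, ?_⟩
  · rw [← he, hJ, e.symm_apply_apply]
  · rw [← he, hJ, e.apply_symm_apply]
  · refine specRadius_le_of_forall_mem_spectrum (by positivity) fun z hz => ?_
    rcases eq_or_ne z 0 with rfl | hz0
    · rw [norm_zero]; positivity
    have hcomp : IsCompactOperator J := 
      have : ProperSpace F := FiniteDimensional.proper ℂ F
      isCompactOperator_of_locallyCompactSpace_dom J
    obtain ⟨u, hu⟩ := ((hcomp.hasEigenvalue_iff_mem_spectrum hz0).2 hz).exists_hasEigenvector
    have h1 : e.symm u = z • u := hu.apply_eq_smul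
    have h2 : e u = z⁻¹ • u := by
      rw [LinearEquiv.symm_apply_eq, map_smul] at h1
      rw [h1, smul_smul, inv_mul_cancel₀ hz0, one_smul, ← h1]
    have h3 := hF.le_norm u u.2 z⁻¹ (by simpa using hu.2) (congrArg Subtype.val h2)
    rw [norm_inv] at h3
    exact (le_inv_comm₀ hρ (norm_pos_iff.2 hz0)).1 h3

/-- Compressing `T` to a complement of a maximal outer subspace produces an operator with
spectral radius smaller than `ρ`. -/
theorem specRadius_compression_lt [CompleteSpace X] {T K : X →L[ℂ] X} (hK : IsCompactOperator K)
    {ρ : ℝ} (hρ : 0 < ρ) {N : ℕ} (hN0 : 0 < N) (hN : ‖T ^ N - K‖ ≤ ρ ^ N / 8) {F : Submodule ℂ X}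
    [FiniteDimensional ℂ F] (hF : ∀ v ∈ F, T v ∈ F)
    (hmax : ∀ (v : X) (z : ℂ), ρ ≤ ‖z‖ → T v - z • v ∈ F → v ∈ F)
    (p : X →L[ℂ] F) (hp : ∀ f : F, p f = f) :
    specRadius (T - F.subtypeL ∘L p ∘L T) < ρ ∧
      ∀ (k : ℕ) (x : X), (T ^ k) x - p ((T ^ k) x)
        = ((T - F.subtypeL ∘L p ∘L T) ^ k) (x - p x) := by
  set S : X →L[ℂ] X := T - F.subtypeL ∘L p ∘L T with hS
  have hSx : ∀ x, S x = T x - p (T x) := fun x => rfl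
  have hSF : ∀ f : F, S f = 0 := fun f => by
    rw [hSx]
    have := hp ⟨T f, hF f f.2⟩
    simp only at this
    rw [this, sub_self]
  have hpS : ∀ x, p (S x) = 0 := fun x => by
    rw [hSx, map_sub, hp, sub_self]
  have hpow : ∀ (k : ℕ) (x : X), (T ^ k) x - p ((T ^ k) x) = (S ^ k) (x - p x) := by
    intro k
    induction k with
    | zero => intro x; rfl
    | succ k ih =>
      intro x
      rw [pow_succ, mul_apply_eq_comp, ih, pow_succ, mul_apply_eq_comp, map_sub S, hSF, sub_zero, hSx]
  refine ⟨specRadius_lt_of_forall_mem_spectrum hρ fun ζ hζ => ?_, hpow⟩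
  by_contra! hcon
  -- S^N = T^N - p T^N, so S^N minus this compact operator is T^N - K: the compression is as close
  -- to a compact operator as T^N is.
  have hcomp : IsCompactOperator (K - F.subtypeL ∘L p ∘L T ^ N : X →L[ℂ] X) := by
    refine hK.sub ?_
    have h1 : IsCompactOperator (p ∘L T ^ N : X →L[ℂ] F) :=
      have : ProperSpace F := FiniteDimensional.proper ℂ F
      isCompactOperator_of_locallyCompactSpace_dom _
    exact h1.clm_comp F.subtypeL
  have hSN : S ^ N = T ^ N - F.subtypeL ∘L p ∘L T ^ N := by
    ext x
    have h1 := hpow N x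
    have h2 : (S ^ N) (p x : X) = 0 := by
      obtain ⟨M, rfl⟩ : ∃ M, N = M + 1 := ⟨N - 1, by omega⟩
      rw [pow_succ, mul_apply_eq_comp, hSF, map_zero]
    rw [map_sub, h2, sub_zero] at h1
    exact h1.symm
  have hpos : 0 < ρ ^ N := by positivity
  have hw : ρ ^ N ≤ ‖ζ ^ N‖ := by
    rw [norm_pow]; gcongr
  obtain ⟨v, hv0, hv⟩ := exists_eigenvector_of_mem_spectrum (S := S ^ N) (w := ζ ^ N) hcomp (by
    rw [hSN, sub_sub_sub_cancel_right]
    linarith) (spectrum.pow_mem_pow S N hζ)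
  obtain ⟨z, u, hz, hu0, hu⟩ := exists_eigenvector_of_pow (S : X →ₗ[ℂ] X) hN0 hv0 (w := ζ ^ N) (by
    rw [← hv, ← ContinuousLinearMap.toLinearMap_pow]; rfl)
  have hzρ : ρ ≤ ‖z‖ := by
    rw [← hz, norm_pow] at hw
    exact le_of_pow_le_pow_left₀ hN0.ne' (norm_nonneg z) hw
  have hz0 : z ≠ 0 := norm_pos_iff.1 (hρ.trans_le hzρ)
  change S u = z • u at hu
  have hpu : p u = 0 := by
    have h1 := hpS u
    rw [hu, map_smul] at h1
    exact (smul_eq_zero.1 h1).resolve_left hz0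
  -- T u - z u = p (T u) lies in F, so maximality puts u in F, where p u = 0 forces u = 0.
  have huF : u ∈ F := by
    refine hmax u z hzρ ?_
    rw [← hu, hSx, sub_sub_cancel]
    exact (p (T u)).2
  have := hp ⟨u, huF⟩
  rw [hpu] at this
  exact hu0 (congrArg Subtype.val this).symm

/-- If some power of `T` is close enough to a compact operator, then the space splits at `ρ`. -/
theorem hasSplitting_of_norm_pow_sub_le [CompleteSpace X] {T K : X →L[ℂ] X}
    (hK : IsCompactOperator K) {ρ : ℝ} (hρ : 0 < ρ) {N : ℕ} (hN0 : 0 < N)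
    (hN : ‖T ^ N - K‖ ≤ ρ ^ N / 8) : HasSplitting T ρ := by
  obtain ⟨F, hF, hmax⟩ := exists_maximal_isOuterSubspace hK hρ hN
  have := hF.finiteDimensional
  have : CompleteSpace F := FiniteDimensional.complete ℂ F
  obtain ⟨p, hp⟩ := Submodule.ClosedComplemented.of_finiteDimensional F
  obtain ⟨hSρ, hpow⟩ := specRadius_compression_lt hK hρ hN0 hN hF.map_mem hmax p hp
  set S : X →L[ℂ] X := T - F.subtypeL ∘L p ∘L T with hS
  obtain ⟨J, hJ1, hJ2, hJρ⟩ := hF.exists_inverse hρ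
  set A : F →L[ℂ] F := T.restrict hF.map_mem with hA
  obtain ⟨q, hq1, hq2⟩ := exists_between hSρ
  have hq0 : 0 < q := (specRadius_nonneg S).trans_lt hq1
  obtain ⟨q', hq'1, hq'2⟩ := exists_between ((inv_lt_inv₀ hρ hq0).2 hq2)
  have hq'0 : 0 < q' := (inv_pos.2 hρ).trans hq'1
  have hqq : q' * q < 1 := by
    have := (mul_lt_mul_iff_left₀ hq0).2 hq'2
    rwa [inv_mul_cancel₀ hq0.ne'] at this
  obtain ⟨C, hC0, hC⟩ := exists_norm_pow_le hq1
  obtain ⟨C', hC'0, hC'⟩ := exists_norm_pow_le (hJρ.trans_lt hq'1)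
  -- p is not T-invariant, but these conjugates of it converge to a projection that is: consecutive
  -- differences pair J^k = O(q'^k) with S^k = O(q^k), and q' q < 1.
  let L : ℕ → X →L[ℂ] F := fun k => (J ^ k) ∘L p ∘L (T ^ k)
  have hLF : ∀ k (f : F), L k f = f := by
    intro k
    induction k with
    | zero => intro f; exact hp f
    | succ k ih =>
      intro f
      change (J ^ (k + 1)) (p ((T ^ (k + 1)) f)) = f
      rw [pow_succ', pow_succ, mul_apply_eq_comp, mul_apply_eq_comp]
      have h1 : (J ^ k) (p ((T ^ k) (A f))) = A f := ih (A f)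
      change J ((J ^ k) (p ((T ^ k) (A f)))) = f
      rw [h1, hJ1]
  have hLA : ∀ k x, A (L (k + 1) x) = L k (T x) := by
    intro k x
    change A ((J ^ (k + 1)) (p ((T ^ (k + 1)) x))) = (J ^ k) (p ((T ^ k) (T x)))
    rw [pow_succ', mul_apply_eq_comp, hJ2, pow_succ, mul_apply_eq_comp]
  have hdiff : ∀ k, L (k + 1) - L k
      = (J ∘L (J ^ k)) ∘L (p ∘L T) ∘L (S ^ k) ∘L (1 - F.subtypeL ∘L p) := by
    intro k
    ext1 x
    change (J ^ (k + 1)) (p ((T ^ (k + 1)) x)) - (J ^ k) (p ((T ^ k) x))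
      = J ((J ^ k) (p (T ((S ^ k) (x - p x)))))
    rw [← hpow, map_sub, map_sub, map_sub, map_sub]
    have h1 : p (T (p ((T ^ k) x))) = A (p ((T ^ k) x)) := hp (A (p ((T ^ k) x)))
    have h2 : ∀ f, J ((J ^ k) (A f)) = (J ^ k) f := fun f => by
      rw [← mul_apply_eq_comp, ← pow_succ', pow_succ, mul_apply_eq_comp, hJ1]
    rw [h1, h2, pow_succ', mul_apply_eq_comp, pow_succ', mul_apply_eq_comp]
  have hCauchy : CauchySeq L := by
    have hk : ∀ k, dist (L k) (L (k + 1)) ≤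
        ‖J‖ * C' * (‖p ∘L T‖ * (C * ‖(1 : X →L[ℂ] X) - F.subtypeL ∘L p‖)) * (q' * q) ^ k := by
      intro k
      rw [dist_comm]
      refine (dist_eq_norm (L (k + 1)) (L k)).le.trans ?_
      rw [hdiff]
      calc _ ≤ (‖J‖ * ‖J ^ k‖) * (‖p ∘L T‖ * (‖S ^ k‖ * ‖(1 : X →L[ℂ] X) - F.subtypeL ∘L p‖)) := by
            refine (ContinuousLinearMap.opNorm_comp_le _ _).trans ?_
            gcongr
            · exact ContinuousLinearMap.opNorm_comp_le _ _
            · refine (ContinuousLinearMap.opNorm_comp_le _ _).trans ?_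
              gcongr
              exact ContinuousLinearMap.opNorm_comp_le _ _
        _ ≤ (‖J‖ * (C' * q' ^ k)) *
            (‖p ∘L T‖ * ((C * q ^ k) * ‖(1 : X →L[ℂ] X) - F.subtypeL ∘L p‖)) := by
            gcongr
            · exact hC' k
            · exact hC k
        _ = _ := by rw [mul_pow]; ring
    exact cauchySeq_of_le_geometric _ _ hqq hk
  obtain ⟨P, hP⟩ := cauchySeq_tendsto_of_complete hCauchy
  have hPx : ∀ x, Tendsto (fun k => L k x) atTop (𝓝 (P x)) := fun x =>
    ((ContinuousLinearMap.apply ℂ F x).continuous.tendsto P).comp hP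
  have hPF : ∀ f : F, P f = f := fun f =>
    tendsto_nhds_unique (hPx f) (by simp only [hLF]; exact tendsto_const_nhds)
  have hPT : ∀ x, P (T x) = A (P x) := fun x => by
    refine tendsto_nhds_unique (hPx (T x)) ?_
    have := (A.continuous.tendsto (P x)).comp ((tendsto_add_atTop_iff_nat 1).2 (hPx x))
    refine this.congr fun k => hLA k x
  have hH : ∀ v ∈ (P : X →ₗ[ℂ] F).ker, T v ∈ (P : X →ₗ[ℂ] F).ker := by
    intro v hv
    have hv' : P v = 0 := hv
    change P (T v) = 0
    rw [hPT, hv', map_zero]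
  have hclosed : IsClosed ((P : X →ₗ[ℂ] F).ker : Set X) := P.isClosed_ker
  refine ⟨F, (P : X →ₗ[ℂ] F).ker, hF.map_mem, hH, LinearMap.isCompl_of_proj hPF, hclosed, ?_,
    hF.finiteDimensional, ?_⟩
  · have : CompleteSpace (P : X →ₗ[ℂ] F).ker := hclosed.completeSpace_coe
    refine (specRadius_le_of_norm_pow_le (C := ‖(1 : X →L[ℂ] X) - F.subtypeL ∘L P‖ *
      (C * ‖(1 : X →L[ℂ] X) - F.subtypeL ∘L p‖)) hq0.le fun k => ?_).trans_lt hq2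
    refine ContinuousLinearMap.opNorm_le_bound _ (by positivity) fun h => ?_
    have hcoe : ∀ (j : ℕ) (g : (P : X →ₗ[ℂ] F).ker), (((T.restrict hH) ^ j) g : X) = (T ^ j) g := by
      intro j
      induction j with
      | zero => intro g; rfl
      | succ j ih =>
        intro g
        rw [pow_succ, mul_apply_eq_comp, ih, pow_succ, mul_apply_eq_comp]; rfl
    have h0 : P ((T ^ k) h) = 0 := by
      rw [← hcoe]; exact (((T.restrict hH) ^ k) h).2
    -- On ker P the orbit is recovered from its component modulo F, which evolves under S. This
    -- transfers the decay of S^k to T restricted to ker P.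
    have h1 : (T ^ k) h = ((1 : X →L[ℂ] X) - F.subtypeL ∘L P) ((S ^ k)
        (((1 : X →L[ℂ] X) - F.subtypeL ∘L p) h)) := by
      change (T ^ k) (h : X) = (S ^ k) ((h : X) - p h) - P ((S ^ k) ((h : X) - p h))
      rw [← hpow, map_sub, h0, hPF]
      simp
    rw [← Submodule.norm_coe, hcoe, h1]
    calc _ ≤ ‖(1 : X →L[ℂ] X) - F.subtypeL ∘L P‖ * (‖S ^ k‖ *
          (‖(1 : X →L[ℂ] X) - F.subtypeL ∘L p‖ * ‖(h : X)‖)) := by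
          refine (ContinuousLinearMap.le_opNorm _ _).trans ?_
          gcongr
          refine (ContinuousLinearMap.le_opNorm _ _).trans ?_
          gcongr
          exact ContinuousLinearMap.le_opNorm _ _
      _ ≤ ‖(1 : X →L[ℂ] X) - F.subtypeL ∘L P‖ * ((C * q ^ k) *
          (‖(1 : X →L[ℂ] X) - F.subtypeL ∘L p‖ * ‖(h : X)‖)) := by
          gcongr
          exact hC k
      _ = _ := by rw [Submodule.norm_coe]; ring
  · intro z hz
    obtain ⟨u, hu⟩ := hz.exists_hasEigenvector
    exact hF.le_norm u u.2 z (by simpa using hu.2) (congrArg Subtype.val hu.apply_eq_smul)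

/-- The space splits at every `ρ` larger than the spectral radius. -/
theorem hasSplitting_of_specRadius_lt [CompleteSpace X] {T : X →L[ℂ] X} {ρ : ℝ}
    (h : specRadius T < ρ) : HasSplitting T ρ := by
  obtain ⟨q, hq1, hq2⟩ := exists_between h
  have hq0 : 0 < q := (specRadius_nonneg T).trans_lt hq1
  have hρ : 0 < ρ := hq0.trans hq2
  have h1 := tendsto_pow_atTop_nhds_zero_of_lt_one (r := q / ρ) (by positivity)
    ((div_lt_one hρ).2 hq2)
  obtain ⟨n, ⟨hn1, hn2⟩, hn3⟩ := ((eventually_norm_pow_le hq1).and (h1.eventually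
    (gt_mem_nhds (show (0 : ℝ) < 1 / 8 by norm_num))) |>.and (eventually_gt_atTop 0)).exists
  refine hasSplitting_of_norm_pow_sub_le (K := 0) isCompactOperator_zero hρ hn3 ?_
  rw [sub_zero]
  rw [div_pow, div_lt_iff₀ (by positivity)] at hn2
  linarith

theorem bddBelow_essSpecRadius (T : X →L[ℂ] X) :
    BddBelow ({specRadius T} ∪ {ρ : ℝ | 0 ≤ ρ ∧ HasSplitting T ρ}) := by
  refine ⟨0, ?_⟩
  rintro ρ (h | h)
  · rw [Set.mem_singleton_iff] at h
    exact h ▸ specRadius_nonneg T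
  · exact h.1

theorem essSpecRadius_le_of_hasSplitting {T : X →L[ℂ] X} {ρ : ℝ} (hρ : 0 ≤ ρ)
    (h : HasSplitting T ρ) : essSpecRadius T ≤ ρ :=
  csInf_le (bddBelow_essSpecRadius T) (Or.inr ⟨hρ, h⟩)

theorem essSpecRadius_nonneg (T : X →L[ℂ] X) : 0 ≤ essSpecRadius T := by
  refine le_csInf ⟨_, Or.inl rfl⟩ ?_
  rintro ρ (h | h)
  · rw [Set.mem_singleton_iff] at h
    exact h ▸ specRadius_nonneg T
  · exact h.1

/-- The extra element r(T) of the infimum is harmless, because the space splits at every number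
above it. -/
theorem exists_hasSplitting_lt [CompleteSpace X] {T : X →L[ℂ] X} {b : ℝ}
    (h : essSpecRadius T < b) : ∃ ρ < b, HasSplitting T ρ := by
  obtain ⟨ρ, hρ, hlt⟩ := exists_lt_of_csInf_lt (Set.Nonempty.inl (Set.singleton_nonempty _)) h
  rcases hρ with hρ | hρ
  · rw [Set.mem_singleton_iff] at hρ
    obtain ⟨r, hr1, hr2⟩ := exists_between hlt
    exact ⟨r, hr2, hasSplitting_of_specRadius_lt (hρ ▸ hr1)⟩
  · exact ⟨ρ, hlt, hρ.2⟩

end Splitting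

/-! ### Powers of a sum modulo compact operators -/

section Perturbation

variable {X : Type*} [NormedAddCommGroup X] [NormedSpace ℂ X]

/-- The terms of the expansion of `(R + T) ^ n` with at most one factor `T`. -/
def firstOrderPart (R T : X →L[ℂ] X) (n : ℕ) : X →L[ℂ] X :=
  R ^ n + ∑ i ∈ Finset.range n, R ^ i * T * R ^ (n - 1 - i)

theorem isCompactOperator_finset_sum {ι : Type*} (s : Finset ι) (G : ι → X →L[ℂ] X)
    (h : ∀ i ∈ s, IsCompactOperator (G i)) : IsCompactOperator (∑ i ∈ s, G i : X →L[ℂ] X) :=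
  (compactOperator (RingHom.id ℂ) X X).sum_mem h

/-- Each remaining word has at least two letters T, hence contains a block T R^i T, and compact
operators form a two-sided ideal. -/
theorem isCompactOperator_pow_sub_firstOrderPart {R T : X →L[ℂ] X}
    (h : ∀ i : ℕ, IsCompactOperator (T * R ^ i * T)) (n : ℕ) :
    IsCompactOperator ((R + T) ^ n - firstOrderPart R T n) := by
  induction n with
  | zero =>
    have h0 : (R + T) ^ 0 - firstOrderPart R T 0 = 0 := by simp [firstOrderPart]
    rw [h0]
    exact isCompactOperator_zero
  | succ n ih =>
    have hsum : firstOrderPart R T (n + 1) = firstOrderPart R T n * R + R ^ n * T := by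
      have h1 : ∀ i ∈ Finset.range n,
          R ^ i * T * R ^ (n + 1 - 1 - i) = R ^ i * T * R ^ (n - 1 - i) * R := by
        intro i hi
        rw [mul_assoc _ _ R, ← pow_succ]
        congr 2
        have := Finset.mem_range.1 hi
        omega
      rw [firstOrderPart, firstOrderPart, Finset.sum_range_succ, Finset.sum_congr rfl h1,
        add_mul, Finset.sum_mul, pow_succ]
      simp [add_assoc]
    -- The finite sum collects the words that acquire their second T from the last factor; all other
    -- discarded words were already discarded at stage n.
    have hsplit : (R + T) ^ (n + 1) - firstOrderPart R T (n + 1)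
        = ((R + T) ^ n - firstOrderPart R T n) * (R + T)
          + ∑ i ∈ Finset.range n, R ^ i * (T * R ^ (n - 1 - i) * T) := by
      have h2 : ∑ i ∈ Finset.range n, R ^ i * (T * R ^ (n - 1 - i) * T)
          = (firstOrderPart R T n - R ^ n) * T := by
        rw [firstOrderPart, add_sub_cancel_left, Finset.sum_mul]
        simp only [mul_assoc]
      rw [h2, hsum, pow_succ]
      noncomm_ring
    rw [hsplit]
    exact (ih.comp_clm (R + T)).add
      (isCompactOperator_finset_sum _ (fun i => R ^ i * (T * R ^ (n - 1 - i) * T))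
        fun i _ => (h _).clm_comp (R ^ i))

/-- There are only n words with one T, so the loss against q^n is linear in n. The division by q is
there because the exponents of R in such a word add up to n - 1. -/
theorem norm_firstOrderPart_le {R T : X →L[ℂ] X} {C q : ℝ} (hC : 0 < C) (hq : 0 < q)
    (h : ∀ n : ℕ, ‖R ^ n‖ ≤ C * q ^ n) (n : ℕ) :
    ‖firstOrderPart R T n‖ ≤ C * q ^ n + C ^ 2 * ‖T‖ / q * (n * q ^ n) := by
  have h1 : ∀ i ∈ Finset.range n,
      ‖R ^ i * T * R ^ (n - 1 - i)‖ ≤ C ^ 2 * ‖T‖ / q * q ^ n := by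
    intro i hi
    have hi' := Finset.mem_range.1 hi
    calc ‖R ^ i * T * R ^ (n - 1 - i)‖ ≤ ‖R ^ i‖ * ‖T‖ * ‖R ^ (n - 1 - i)‖ := by
          refine (norm_mul_le _ _).trans ?_
          gcongr
          exact norm_mul_le _ _
      _ ≤ (C * q ^ i) * ‖T‖ * (C * q ^ (n - 1 - i)) := by
          gcongr
          · exact h i
          · exact h _
      _ = C ^ 2 * ‖T‖ / q * (q ^ i * q ^ (n - 1 - i) * q) := by field_simp
      _ = _ := by
          rw [← pow_add, ← pow_succ]
          congr 2
          omega
  refine (norm_add_le _ _).trans (add_le_add (h n) ((norm_sum_le _ _).trans ?_))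
  refine (Finset.sum_le_sum h1).trans (le_of_eq ?_)
  rw [Finset.sum_const, Finset.card_range, nsmul_eq_mul]
  ring

/-- If `Q ^ ℓ = R + T` where all operators `T R ^ i T` are compact, then `Q` splits at `ρ` as soon
as `r(R) < ρ ^ ℓ`. -/
theorem hasSplitting_of_eq_add [CompleteSpace X] {Q R T : X →L[ℂ] X} {ℓ : ℕ} (hℓ : 0 < ℓ) (hQ : Q ^ ℓ = R + T)
    (h : ∀ i : ℕ, IsCompactOperator (T * R ^ i * T)) {ρ : ℝ} (hρ : 0 < ρ)
    (hR : specRadius R < ρ ^ ℓ) : HasSplitting Q ρ := by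
  obtain ⟨q, hq1, hq2⟩ := exists_between hR
  have hq0 : 0 < q := (specRadius_nonneg R).trans_lt hq1
  obtain ⟨C, hC0, hC⟩ := exists_norm_pow_le hq1
  set s : ℝ := ρ ^ ℓ with hs
  have hs0 : 0 < s := by positivity
  have hr1 : q / s < 1 := (div_lt_one hs0).2 hq2
  have hr0 : 0 ≤ q / s := by positivity
  have hlim : Tendsto (fun n : ℕ => C * (q / s) ^ n + C ^ 2 * ‖T‖ / q * (n * (q / s) ^ n)) atTop
      (𝓝 (C * 0 + C ^ 2 * ‖T‖ / q * 0)) :=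
    ((tendsto_pow_atTop_nhds_zero_of_lt_one hr0 hr1).const_mul C).add
      ((tendsto_self_mul_const_pow_of_lt_one hr0 hr1).const_mul _)
  rw [mul_zero, mul_zero, add_zero] at hlim
  obtain ⟨n, hn, hn0⟩ := ((hlim.eventually (gt_mem_nhds (show (0 : ℝ) < 1 / 8 by norm_num))).and
    (eventually_gt_atTop 0)).exists
  refine hasSplitting_of_norm_pow_sub_le (N := ℓ * n)
    (isCompactOperator_pow_sub_firstOrderPart h n) hρ (by positivity) ?_
  rw [pow_mul, hQ, sub_sub_cancel, pow_mul, ← hs]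
  refine (norm_firstOrderPart_le hC0 hq0 hC n).trans ?_
  have h1 : C * q ^ n + C ^ 2 * ‖T‖ / q * (n * q ^ n)
      = (C * (q / s) ^ n + C ^ 2 * ‖T‖ / q * (n * (q / s) ^ n)) * s ^ n := by
    rw [div_pow]
    field_simp
  rw [h1]
  have : 0 < s ^ n := by positivity
  nlinarith

end Perturbation

/-! ### Approximation by rectangles in L¹ of a finite measure on the square -/

section RectangleApproximation

variable {E : Type*} [MeasurableSpace E]

/-- Linear combinations of indicator functions of measurable rectangles. -/
def rectangleSpan (E : Type*) [MeasurableSpace E] : Submodule ℂ (E × E → ℂ) :=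
  Submodule.span ℂ {g | ∃ A B : Set E, MeasurableSet A ∧ MeasurableSet B ∧
    g = (A ×ˢ B).indicator 1}

theorem indicator_mem_rectangleSpan {A B : Set E} (hA : MeasurableSet A) (hB : MeasurableSet B) :
    (A ×ˢ B).indicator (1 : E × E → ℂ) ∈ rectangleSpan E :=
  Submodule.subset_span ⟨A, B, hA, hB, rfl⟩

theorem measurable_of_mem_rectangleSpan {g : E × E → ℂ} (hg : g ∈ rectangleSpan E) :
    Measurable g := by
  induction hg using Submodule.span_induction with
  | mem g hg =>
    obtain ⟨A, B, hA, hB, rfl⟩ := hg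
    exact measurable_one.indicator (hA.prod hB)
  | zero => exact measurable_zero
  | add f g _ _ hf hg => exact hf.add hg
  | smul c g _ hg => exact hg.const_smul c

theorem exists_bound_of_mem_rectangleSpan {g : E × E → ℂ} (hg : g ∈ rectangleSpan E) :
    ∃ C : ℝ, ∀ z, ‖g z‖ ≤ C := by
  induction hg using Submodule.span_induction with
  | mem g hg =>
    obtain ⟨A, B, hA, hB, rfl⟩ := hg
    refine ⟨1, fun z => (norm_indicator_le_norm_self _ _).trans (by simp)⟩
  | zero => exact ⟨0, by simp⟩
  | add f g _ _ hf hg =>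
    obtain ⟨C, hC⟩ := hf
    obtain ⟨D, hD⟩ := hg
    exact ⟨C + D, fun z => (norm_add_le _ _).trans (add_le_add (hC z) (hD z))⟩
  | smul c g _ hg =>
    obtain ⟨C, hC⟩ := hg
    refine ⟨‖c‖ * C, fun z => ?_⟩
    rw [Pi.smul_apply, norm_smul]
    exact mul_le_mul_of_nonneg_left (hC z) (norm_nonneg c)

/-- Measurable rectangles form a π-system generating the product σ-algebra, so it suffices to pass
to complements and countable disjoint unions. -/
theorem exists_rectangleSpan_indicator_close (π : Measure (E × E)) [IsFiniteMeasure π]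
    {S : Set (E × E)} (hS : MeasurableSet S) :
    ∀ ε : ℝ≥0∞, ε ≠ 0 → ∃ g ∈ rectangleSpan E,
      ∫⁻ z, ‖S.indicator (1 : E × E → ℂ) z - g z‖ₑ ∂π ≤ ε := by
  induction S, hS using MeasurableSpace.induction_on_inter generateFrom_prod.symm isPiSystem_prod with
  | empty => exact fun ε _ => ⟨0, Submodule.zero_mem _, by simp⟩
  | basic S hS =>
    obtain ⟨A, hA, B, hB, rfl⟩ := hS
    exact fun ε _ => ⟨_, indicator_mem_rectangleSpan hA hB, by simp⟩
  | compl S hS ih =>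
    intro ε hε
    obtain ⟨g, hg, h⟩ := ih ε hε
    have h1 : (Set.univ ×ˢ Set.univ : Set (E × E)).indicator (1 : E × E → ℂ) ∈ rectangleSpan E :=
      indicator_mem_rectangleSpan MeasurableSet.univ MeasurableSet.univ
    rw [Set.univ_prod_univ, Set.indicator_univ] at h1
    refine ⟨1 - g, Submodule.sub_mem _ h1 hg, le_of_eq_of_le (lintegral_congr fun z => ?_) h⟩
    rw [Set.indicator_compl, Pi.sub_apply, Pi.sub_apply, ← enorm_neg]
    congr 1
    ring
  | iUnion f hd hf ih =>
    intro ε hε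
    have hε2 : ε / 2 ≠ 0 := (ENNReal.half_pos hε).ne'
    have hU : MeasurableSet (⋃ i, f i) := MeasurableSet.iUnion hf
    have hlim := tendsto_measure_iUnion_accumulate (μ := π) (f := f)
    have hA : ∀ n, MeasurableSet (Set.accumulate f n) := fun n =>
      MeasurableSet.biUnion (Set.to_countable _) fun i _ => hf i
    have hsub : ∀ n, Set.accumulate f n ⊆ ⋃ i, f i := fun n => Set.accumulate_subset_iUnion n
    have hlim2 : Tendsto (fun n => π ((⋃ i, f i) \ Set.accumulate f n)) atTop (𝓝 0) := by
      have h1 := ENNReal.Tendsto.sub (tendsto_const_nhds (x := π (⋃ i, f i)) (f := atTop)) hlim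
        (Or.inl (measure_ne_top _ _))
      rw [tsub_self] at h1
      refine h1.congr fun n => ?_
      rw [measure_sdiff (hsub n) (hA n).nullMeasurableSet (measure_ne_top _ _)]
    -- Half of ε pays for the tail of the union, the other half is shared equally by the n + 1 sets
    -- kept.
    obtain ⟨n, hn⟩ := (hlim2.eventually (ge_mem_nhds (pos_iff_ne_zero.2 hε2))).exists
    have hεn : ε / 2 / (n + 1 : ℕ) ≠ 0 := by
      exact (ENNReal.div_pos hε2 (ENNReal.natCast_ne_top _)).ne'
    choose g hg hgε using fun i => ih i (ε / 2 / (n + 1 : ℕ)) hεn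
    refine ⟨∑ i ∈ Finset.range (n + 1), g i, Submodule.sum_mem _ fun i _ => hg i, ?_⟩
    have hacc : ∀ z, (Set.accumulate f n).indicator (1 : E × E → ℂ) z
        = ∑ i ∈ Finset.range (n + 1), (f i).indicator (1 : E × E → ℂ) z := by
      intro z
      have h1 : Set.accumulate f n = ⋃ i ∈ Finset.range (n + 1), f i := by
        ext z
        simp [Set.accumulate]
      rw [h1, Finset.indicator_biUnion_apply]
      exact fun i _ j _ hij => hd hij
    have hpt : ∀ z, ‖(⋃ i, f i).indicator (1 : E × E → ℂ) z
          - (∑ i ∈ Finset.range (n + 1), g i) z‖ₑ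
        ≤ ((⋃ i, f i) \ Set.accumulate f n).indicator (1 : E × E → ℝ≥0∞) z
          + ∑ i ∈ Finset.range (n + 1), ‖(f i).indicator (1 : E × E → ℂ) z - g i z‖ₑ := by
      intro z
      have h1 : (⋃ i, f i).indicator (1 : E × E → ℂ) z - (∑ i ∈ Finset.range (n + 1), g i) z
          = ((⋃ i, f i) \ Set.accumulate f n).indicator (1 : E × E → ℂ) z
            + ∑ i ∈ Finset.range (n + 1), ((f i).indicator (1 : E × E → ℂ) z - g i z) := by
        rw [Set.indicator_sdiff (hsub n), Pi.sub_apply, Finset.sum_sub_distrib, ← hacc,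
          Finset.sum_apply]
        ring
      rw [h1]
      refine (enorm_add_le _ _).trans (add_le_add (le_of_eq ?_) (enorm_sum_le _ _))
      by_cases hz : z ∈ (⋃ i, f i) \ Set.accumulate f n
      · simp only [Set.indicator_of_mem hz, Pi.one_apply, enorm_one]
      · simp only [Set.indicator_of_notMem hz, enorm_zero]
    have hmeas : ∀ i, Measurable fun z => ‖(f i).indicator (1 : E × E → ℂ) z - g i z‖ₑ := fun i =>
      ((measurable_one.indicator (hf i)).sub (measurable_of_mem_rectangleSpan (hg i))).enorm
    calc _ ≤ ∫⁻ z, (((⋃ i, f i) \ Set.accumulate f n).indicator (1 : E × E → ℝ≥0∞) z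
          + ∑ i ∈ Finset.range (n + 1), ‖(f i).indicator (1 : E × E → ℂ) z - g i z‖ₑ) ∂π :=
          lintegral_mono hpt
      _ = π ((⋃ i, f i) \ Set.accumulate f n)
          + ∑ i ∈ Finset.range (n + 1), ∫⁻ z, ‖(f i).indicator (1 : E × E → ℂ) z - g i z‖ₑ ∂π := by
          rw [lintegral_add_left (measurable_one.indicator (hU.diff (hA n))),
            lintegral_indicator_one (hU.diff (hA n)), lintegral_finsetSum _ fun i _ => hmeas i]
      _ ≤ ε / 2 + ∑ i ∈ Finset.range (n + 1), ε / 2 / (n + 1 : ℕ) := by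
          gcongr with i
          exact hgε i
      _ ≤ ε := by
          rw [Finset.sum_const, Finset.card_range, nsmul_eq_mul,
            ENNReal.mul_div_cancel (by simp) (ENNReal.natCast_ne_top _), ENNReal.add_halves]

/-- The error is small only on average over the first variable, not uniformly in it. This is why
compactness is later proved for a product of two operators. -/
theorem exists_rectangleSpan_close (π : Measure (E × E)) [IsFiniteMeasure π]
    {f : E × E → ℂ} (hf : Integrable f π) {ε : ℝ≥0∞} (hε : ε ≠ 0) :
    ∃ g ∈ rectangleSpan E, ∫⁻ z, ‖f z - g z‖ₑ ∂π ≤ ε := by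
  have hind : ∀ (c : ℂ) ⦃S : Set (E × E)⦄, MeasurableSet S → π S < ⊤ → ∀ {η : ℝ≥0∞}, η ≠ 0 →
      ∃ g : E × E → ℂ, eLpNorm (g - S.indicator fun _ => c) 1 π ≤ η ∧ g ∈ rectangleSpan E := by
    intro c S hS _ η hη
    obtain ⟨δ, hδ, hδη⟩ := ENNReal.exists_pos_mul_lt (a := ‖c‖ₑ) (b := η) enorm_ne_top hη
    obtain ⟨g, hg, hgδ⟩ := exists_rectangleSpan_indicator_close π hS δ hδ.ne'
    refine ⟨c • g, ?_, Submodule.smul_mem _ c hg⟩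
    rw [eLpNorm_one_eq_lintegral_enorm]
    have h1 : ∀ z, ‖(c • g - S.indicator fun _ => c) z‖ₑ
        = ‖c‖ₑ * ‖S.indicator (1 : E × E → ℂ) z - g z‖ₑ := by
      intro z
      rw [← enorm_mul, ← enorm_neg]
      congr 1
      by_cases hz : z ∈ S <;> simp [hz, mul_sub]
    have hm : Measurable fun z => ‖S.indicator (1 : E × E → ℂ) z - g z‖ₑ :=
      ((measurable_one.indicator hS).sub (measurable_of_mem_rectangleSpan hg)).enorm
    rw [lintegral_congr h1, lintegral_const_mul _ hm]
    refine (mul_le_mul_right hgδ _).trans ?_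
    rw [mul_comm]
    exact hδη.le
  obtain ⟨g, hg, hgP⟩ := (memLp_one_iff_integrable.2 hf).induction_dense ENNReal.one_ne_top
    (fun g => g ∈ rectangleSpan E) hind (fun _ _ => Submodule.add_mem _)
    (fun g hg => (measurable_of_mem_rectangleSpan hg).aestronglyMeasurable) hε
  refine ⟨g, hgP, ?_⟩
  rw [eLpNorm_one_eq_lintegral_enorm] at hg
  exact hg

end RectangleApproximation

/-! ### Compactness of products of integral operators -/

section CompactProducts

variable {E : Type*} [MeasurableSpace E]

/-- The indicator function of a measurable set as a bounded measurable function. -/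
def indicatorBdd (A : Set E) (hA : MeasurableSet A) : BddMeas E :=
  ⟨⟨A.indicator 1, memℓp_infty ⟨1, by
    rintro _ ⟨x, rfl⟩
    exact (norm_indicator_le_norm_self _ _).trans (by simp)⟩⟩, measurable_one.indicator hA⟩

theorem indicatorBdd_apply {A : Set E} (hA : MeasurableSet A) (x : E) :
    indicatorBdd A hA x = A.indicator (1 : E → ℂ) x := rfl

theorem norm_indicatorBdd_le {A : Set E} (hA : MeasurableSet A) : ‖indicatorBdd A hA‖ ≤ 1 :=
  BddMeas.norm_le zero_le_one fun x => by
    rw [indicatorBdd_apply]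
    exact (norm_indicator_le_norm_self _ _).trans (by simp)

/-- Integration against a finite measure as a functional on bounded measurable functions. -/
def integralCLM (μ : Measure E) [IsFiniteMeasure μ] : BddMeas E →L[ℂ] ℂ :=
  LinearMap.mkContinuous
    { toFun := fun f => ∫ y, f y ∂μ
      map_add' := fun f g => integral_add (integrable_bddMeas μ f) (integrable_bddMeas μ g)
      map_smul' := fun c f => integral_const_mul c (fun y => f y) }
    (μ.real Set.univ)
    (fun f => by
      rw [mul_comm]
      exact norm_integral_le_of_norm_le_const (ae_of_all _ fun y => f.norm_apply_le y))

theorem measurable_slice {β : Type*} [MeasurableSpace β] {α : E × E → β} (hα : Measurable α)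
    (x : E) : Measurable fun y => α (x, y) :=
  hα.comp measurable_prodMk_left

theorem integrable_mul_bddMeas {ν : Measure E} [IsFiniteMeasure ν] {a : E → ℂ} (ha : Measurable a)
    {C : ℝ} (hC : ∀ y, ‖a y‖ ≤ C) (f : BddMeas E) : Integrable (fun y => a y * f y) ν := by
  refine Integrable.of_bound (ha.mul f.measurable).aestronglyMeasurable (C * ‖f‖)
    (ae_of_all _ fun y => ?_)
  rw [norm_mul]
  exact mul_le_mul (hC y) (f.norm_apply_le y) (norm_nonneg _) ((norm_nonneg _).trans (hC y))

/-- Integral operators whose density is a combination of rectangles are compact. -/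
theorem exists_compact_of_mem_rectangleSpan (ν : Measure E) [IsFiniteMeasure ν] {g : E × E → ℂ}
    (hg : g ∈ rectangleSpan E) : ∃ G : BddMeas E →L[ℂ] BddMeas E, IsCompactOperator G ∧
      ∀ f x, G f x = ∫ y, g (x, y) * f y ∂ν := by
  induction hg using Submodule.span_induction with
  | mem g hg =>
    obtain ⟨A, B, hA, hB, rfl⟩ := hg
    refine ⟨(integralCLM (ν.restrict B)).smulRight (indicatorBdd A hA), ?_, fun f x => ?_⟩
    · have h1 : IsCompactOperator (integralCLM (ν.restrict B)) :=
        isCompactOperator_of_locallyCompactSpace_dom _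
      exact h1.clm_comp (ContinuousLinearMap.toSpanSingleton ℂ (indicatorBdd A hA))
    · change (∫ y, f y ∂(ν.restrict B)) * A.indicator (1 : E → ℂ) x = _
      rw [← integral_indicator hB, ← integral_mul_const]
      refine integral_congr_ae (ae_of_all _ fun y => ?_)
      by_cases hx : x ∈ A <;> by_cases hy : y ∈ B <;> simp [Set.indicator, hx, hy]
  | zero => exact ⟨0, isCompactOperator_zero, fun f x => by simp; rfl⟩
  | add g h hgm hhm hg hh =>
    obtain ⟨G, hG, hG'⟩ := hg
    obtain ⟨H, hH, hH'⟩ := hh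
    obtain ⟨C, hC⟩ := exists_bound_of_mem_rectangleSpan hgm
    obtain ⟨D, hD⟩ := exists_bound_of_mem_rectangleSpan hhm
    refine ⟨G + H, hG.add hH, fun f x => ?_⟩
    change G f x + H f x = _
    rw [hG', hH', ← integral_add
      (integrable_mul_bddMeas (measurable_slice (measurable_of_mem_rectangleSpan hgm) x)
        (fun y => hC (x, y)) f)
      (integrable_mul_bddMeas (measurable_slice (measurable_of_mem_rectangleSpan hhm) x)
        (fun y => hD (x, y)) f)]
    refine integral_congr_ae (ae_of_all _ fun y => ?_)
    simp [add_mul]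
  | smul c g _ hg =>
    obtain ⟨G, hG, hG'⟩ := hg
    refine ⟨c • G, hG.smul c, fun f x => ?_⟩
    change c * G f x = _
    rw [hG', ← integral_const_mul]
    refine integral_congr_ae (ae_of_all _ fun y => ?_)
    simp [mul_assoc]

theorem BddMeas.enorm_apply_le (f : BddMeas E) (x : E) : ‖f x‖ₑ ≤ ‖f‖ₑ :=
  enorm_le_iff_norm_le.2 (f.norm_apply_le x)

/-- The product of an operator dominated by a finite measure with an integral operator with bounded
density is compact. -/
theorem isCompactOperator_mul_of_density {W T : BddMeas E →L[ℂ] BddMeas E} (μ ν : Measure E)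
    [IsFiniteMeasure μ] [IsFiniteMeasure ν] (hW : ∀ f x, ‖W f x‖ₑ ≤ ∫⁻ y, ‖f y‖ₑ ∂μ)
    {α : E × E → ℂ} (hα : Measurable α) {m : ℝ} (hm : ∀ z, ‖α z‖ ≤ m)
    (hT : ∀ f x, T f x = ∫ y, α (x, y) * f y ∂ν) : IsCompactOperator (W * T) := by
  have hclosed : IsClosed {f : BddMeas E →L[ℂ] BddMeas E | IsCompactOperator f} :=
    isClosed_setOfPred_isCompactOperator
  refine hclosed.closure_subset (Metric.mem_closure_iff.2 fun ε hε => ?_)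
  have hint : Integrable α (μ.prod ν) :=
    Integrable.of_bound hα.aestronglyMeasurable m (ae_of_all _ hm)
  obtain ⟨g, hg, hgε⟩ := exists_rectangleSpan_close (μ.prod ν) hint
    (ENNReal.ofReal_pos.2 (half_pos hε)).ne'
  obtain ⟨G, hG, hG'⟩ := exists_compact_of_mem_rectangleSpan ν hg
  obtain ⟨C, hC⟩ := exists_bound_of_mem_rectangleSpan hg
  have hgm := measurable_of_mem_rectangleSpan hg
  refine ⟨W * G, hG.clm_comp W, ?_⟩
  have hd : Measurable fun z => ‖α z - g z‖ₑ := (hα.sub hgm).enorm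
  have hpt : ∀ f x, ‖(T f - G f : BddMeas E) x‖ₑ ≤ (∫⁻ y, ‖α (x, y) - g (x, y)‖ₑ ∂ν) * ‖f‖ₑ := by
    intro f x
    have h1 : (T f - G f : BddMeas E) x = ∫ y, (α (x, y) - g (x, y)) * f y ∂ν := by
      change T f x - G f x = _
      rw [hT, hG', ← integral_sub
        (integrable_mul_bddMeas (measurable_slice hα x) (fun y => hm (x, y)) f)
        (integrable_mul_bddMeas (measurable_slice hgm x) (fun y => hC (x, y)) f)]
      refine integral_congr_ae (ae_of_all _ fun y => ?_)
      simp [sub_mul]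
    rw [h1]
    refine (enorm_integral_le_lintegral_enorm _).trans ?_
    rw [← lintegral_mul_const _ (measurable_slice hd x)]
    refine lintegral_mono fun y => ?_
    rw [enorm_mul]
    gcongr
    exact f.enorm_apply_le y
  -- W integrates the slicewise errors of G against μ, which turns them into the L¹(μ ⊗ ν) error of
  -- g.
  have hle : ‖W * T - W * G‖ ≤ ε / 2 := by
    refine ContinuousLinearMap.opNorm_le_bound _ (half_pos hε).le fun f => ?_
    refine BddMeas.norm_le (by positivity) fun x => ?_
    have h1 : (W * T - W * G) f = W (T f - G f) := by
      rw [map_sub]; rfl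
    rw [h1]
    have h2 : ‖W (T f - G f) x‖ₑ ≤ ENNReal.ofReal (ε / 2) * ‖f‖ₑ := by
      calc _ ≤ ∫⁻ y, ‖(T f - G f : BddMeas E) y‖ₑ ∂μ := hW _ _
        _ ≤ ∫⁻ x, (∫⁻ y, ‖α (x, y) - g (x, y)‖ₑ ∂ν) * ‖f‖ₑ ∂μ := lintegral_mono fun y => hpt f y
        _ = (∫⁻ z, ‖α z - g z‖ₑ ∂(μ.prod ν)) * ‖f‖ₑ := by
          rw [lintegral_mul_const _ hd.lintegral_prod_right', lintegral_prod _ hd.aemeasurable]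
        _ ≤ _ := by gcongr
    have h3 := ENNReal.toReal_mono (ENNReal.mul_ne_top ENNReal.ofReal_ne_top enorm_ne_top) h2
    rwa [toReal_enorm, ENNReal.toReal_mul, ENNReal.toReal_ofReal (half_pos hε).le,
      toReal_enorm] at h3
  refine (dist_eq_norm (W * T) (W * G)).trans_lt (hle.trans_lt (half_lt_self hε))

end CompactProducts

/-! ### Domination of operators by kernels -/

section Domination

variable {E : Type*} [MeasurableSpace E]

theorem enorm_kernelOp_apply_le (K : Kernel E E) [IsFiniteKernel K] (f : BddMeas E) (x : E) :
    ‖kernelOp K f x‖ₑ ≤ ∫⁻ y, ‖f y‖ₑ ∂(K x) := by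
  rw [kernelOp_apply]
  exact enorm_integral_le_lintegral_enorm _

theorem KernelLE.le {T K : Kernel E E} (h : KernelLE T K) (x : E) : T x ≤ K x :=
  Measure.le_iff.2 fun A hA => h x A hA

/-- For `T ≤ K` the operator `K - T` is integration against the positive measures `K x - T x`. -/
theorem kernelOp_sub_apply {T K : Kernel E E} [IsFiniteKernel T] [IsFiniteKernel K]
    (h : KernelLE T K) (f : BddMeas E) (x : E) :
    (kernelOp K - kernelOp T) f x = ∫ y, f y ∂(K x - T x) := by
  have h1 : K x = (K x - T x) + T x := (Measure.sub_add_cancel_of_le (h.le x)).symm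
  change kernelOp K f x - kernelOp T f x = _
  rw [kernelOp_apply, kernelOp_apply]
  nth_rewrite 1 [h1]
  rw [integral_add_measure (integrable_bddMeas _ f) (integrable_bddMeas _ f), add_sub_cancel_right]

/-- This is where T ≤ K matters: K x - T x is then a positive measure below K x, and domination by
K, unlike a norm bound, passes to powers pointwise. -/
theorem enorm_kernelOp_sub_apply_le {T K : Kernel E E} [IsFiniteKernel T] [IsFiniteKernel K]
    (h : KernelLE T K) (f : BddMeas E) (x : E) :
    ‖(kernelOp K - kernelOp T) f x‖ₑ ≤ ∫⁻ y, ‖f y‖ₑ ∂(K x) := by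
  rw [kernelOp_sub_apply h]
  exact (enorm_integral_le_lintegral_enorm _).trans (lintegral_mono' Measure.sub_le le_rfl)

theorem enorm_pow_apply_le {R : BddMeas E →L[ℂ] BddMeas E} {K : Kernel E E}
    (h : ∀ f x, ‖R f x‖ₑ ≤ ∫⁻ y, ‖f y‖ₑ ∂(K x)) (i : ℕ) (f : BddMeas E) (x : E) :
    ‖(R ^ i) f x‖ₑ ≤ ∫⁻ y, ‖f y‖ₑ ∂((K ^ i) x) := by
  induction i generalizing x with
  | zero =>
    refine le_of_eq ?_
    exact (lintegral_dirac' x f.measurable.enorm).symm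
  | succ i ih =>
    rw [pow_succ', mul_apply_eq_comp]
    refine (h _ _).trans ((lintegral_mono fun y => ih y).trans (le_of_eq ?_))
    rw [pow_succ]
    exact (Kernel.lintegral_comp (K ^ i) K x f.measurable.enorm).symm

/-- `T` is the kernel with density `α` with respect to `ν`. -/
def HasDensity (T : Kernel E E) (ν : Measure E) (α : E × E → ℝ≥0) : Prop :=
  ∀ x, ∀ A, MeasurableSet A → T x A = ∫⁻ y in A, (α (x, y) : ℝ≥0∞) ∂ν

theorem HasDensity.eq_withDensity {T : Kernel E E} {ν : Measure E} {α : E × E → ℝ≥0}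
    (h : HasDensity T ν α) (x : E) : T x = ν.withDensity fun y => (α (x, y) : ℝ≥0∞) := by
  refine Measure.ext fun A hA => ?_
  rw [h x A hA, withDensity_apply _ hA]

theorem HasDensity.kernelOp_apply {T : Kernel E E} [IsFiniteKernel T] {ν : Measure E}
    {α : E × E → ℝ≥0} (h : HasDensity T ν α) (hα : Measurable α) (f : BddMeas E) (x : E) :
    kernelOp T f x = ∫ y, ((α (x, y) : ℝ) : ℂ) * f y ∂ν := by
  rw [KernelQC.kernelOp_apply, h.eq_withDensity,
    integral_withDensity_eq_integral_smul (measurable_slice hα x)]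
  refine integral_congr_ae (ae_of_all _ fun y => ?_)
  simp [NNReal.smul_def]

/-- Since the density is at most m, the operator T R^i is dominated at every point by the same
finite measure m ν K^i, and `isCompactOperator_mul_of_density` applies. -/
theorem HasDensity.isCompactOperator_mul_pow_mul {T K : Kernel E E} [IsFiniteKernel T]
    [IsFiniteKernel K] {ν : Measure E} [IsFiniteMeasure ν] {α : E × E → ℝ≥0}
    (h : HasDensity T ν α) (hα : Measurable α) {m : ℝ≥0} (hm : ∀ z, α z ≤ m)
    {R : BddMeas E →L[ℂ] BddMeas E} (hR : ∀ f x, ‖R f x‖ₑ ≤ ∫⁻ y, ‖f y‖ₑ ∂(K x)) (i : ℕ) :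
    IsCompactOperator (kernelOp T * R ^ i * kernelOp T) := by
  refine isCompactOperator_mul_of_density (m • ν.bind (K ^ i)) ν (fun f x => ?_)
    (α := fun z => ((α z : ℝ) : ℂ)) (by fun_prop) (m := m) (fun z => ?_)
    (fun f x => h.kernelOp_apply hα f x)
  · rw [mul_apply_eq_comp]
    calc _ ≤ ∫⁻ y, ‖(R ^ i) f y‖ₑ ∂(T x) := enorm_kernelOp_apply_le T _ x
      _ = ∫⁻ y, α (x, y) * ‖(R ^ i) f y‖ₑ ∂ν := by
        rw [h.eq_withDensity, lintegral_withDensity_eq_lintegral_mul _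
          (measurable_slice hα x).coe_nnreal_ennreal ((R ^ i) f).measurable.enorm]
        rfl
      _ ≤ ∫⁻ y, m * ∫⁻ z, ‖f z‖ₑ ∂((K ^ i) y) ∂ν := by
        refine lintegral_mono fun y => mul_le_mul' ?_ (enorm_pow_apply_le hR i f y)
        exact ENNReal.coe_le_coe.2 (hm (x, y))
      _ = _ := by
        rw [lintegral_const_mul _ f.measurable.enorm.lintegral_kernel, lintegral_smul_measure,
          Measure.lintegral_bind (K ^ i).measurable.aemeasurable f.measurable.enorm.aemeasurable]
        rfl
  · rw [Complex.norm_real, Real.norm_of_nonneg (NNReal.coe_nonneg _)]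
    exact_mod_cast hm z

end Domination

/-! ### Truncated densities and the upper bound for the essential spectral radius -/

section Truncation

variable {E : Type*} [MeasurableSpace E]

theorem exists_kernel_hasDensity (ν : Measure E) [IsFiniteMeasure ν] {β : E × E → ℝ≥0}
    (hβ : Measurable β) {m : ℝ≥0} (hm : ∀ z, β z ≤ m) :
    ∃ T : Kernel E E, IsFiniteKernel T ∧ HasDensity T ν β := by
  refine ⟨Kernel.withDensity (Kernel.const E ν) fun x y => (β (x, y) : ℝ≥0∞), ?_, ?_⟩
  · exact Kernel.isFiniteKernel_withDensity_of_bounded _ (B := m) ENNReal.coe_ne_top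
      fun x y => ENNReal.coe_le_coe.2 (hm (x, y))
  · intro x A _
    rw [Kernel.withDensity_apply' _ hβ.coe_nnreal_ennreal, Kernel.const_apply]

theorem HasDensity.kernelLE {T T' : Kernel E E} {ν : Measure E} {α β : E × E → ℝ≥0}
    (h : HasDensity T ν α) (h' : HasDensity T' ν β) (hle : ∀ z, α z ≤ β z) : KernelLE T T' := by
  intro x A hA
  rw [h x A hA, h' x A hA]
  exact lintegral_mono fun y => ENNReal.coe_le_coe.2 (hle (x, y))

/-- The norm of the operator of a positive difference is controlled by its total masses. -/
theorem norm_kernelOp_sub_le {T K : Kernel E E} [IsFiniteKernel T] [IsFiniteKernel K]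
    (h : KernelLE T K) {c : ℝ≥0∞} (hc : c ≠ ⊤) (hle : ∀ x, K x Set.univ ≤ T x Set.univ + c) :
    ‖kernelOp K - kernelOp T‖ ≤ c.toReal := by
  refine ContinuousLinearMap.opNorm_le_bound _ ENNReal.toReal_nonneg fun f =>
    BddMeas.norm_le (by positivity) fun x => ?_
  rw [kernelOp_sub_apply h]
  have h1 : (K x - T x) Set.univ ≤ c := by
    rw [Measure.sub_apply MeasurableSet.univ (h.le x), tsub_le_iff_left]
    exact hle x
  refine (norm_integral_le_of_norm_le_const (ae_of_all _ fun y => f.norm_apply_le y)).trans ?_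
  rw [mul_comm]
  exact mul_le_mul_of_nonneg_right (ENNReal.toReal_mono hc h1) (norm_nonneg f)

theorem UnifIntDensity.of_le {ν : Measure E} {β : E × E → ℝ≥0} (hβ : Measurable β) {m : ℕ}
    (hm : ∀ z, β z ≤ m) : UnifIntDensity ν β := by
  refine ⟨hβ, tendsto_const_nhds.congr' ?_⟩
  filter_upwards [eventually_gt_atTop m] with k hk
  refine (ENNReal.iSup_eq_zero.2 fun x => ?_).symm
  have : {y | (k : ℝ≥0) ≤ β (x, y)} = ∅ := by
    refine Set.eq_empty_of_forall_notMem fun y hy => ?_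
    have h1 : (k : ℝ≥0) ≤ m := le_trans hy (hm (x, y))
    exact absurd (Nat.cast_le.1 h1) (not_le.2 hk)
  rw [this, Measure.restrict_empty, lintegral_zero_measure]

/-- A kernel of class `𝒦*` is approximated in norm by kernels with bounded densities. -/
theorem exists_truncation {T : Kernel E E} [IsFiniteKernel T] {ν : Measure E}
    [IsProbabilityMeasure ν] {α : E × E → ℝ≥0} (hα : UnifIntDensity ν α) (h : HasDensity T ν α)
    {ε : ℝ} (hε : 0 < ε) :
    ∃ (T' : Kernel E E) (_ : IsFiniteKernel T') (β : E × E → ℝ≥0) (m : ℝ≥0), Measurable β ∧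
      (∀ z, β z ≤ m) ∧ HasDensity T' ν β ∧ KernelLE T' T ∧ ‖kernelOp T - kernelOp T'‖ ≤ ε := by
  obtain ⟨m, hm⟩ := (hα.2.eventually (ge_mem_nhds (ENNReal.ofReal_pos.2 hε))).exists
  have hβ : Measurable fun z => min (α z) (m : ℝ≥0) := hα.1.min measurable_const
  obtain ⟨T', hT', hd⟩ := exists_kernel_hasDensity ν hβ (m := m) fun z => min_le_right _ _
  have hle : KernelLE T' T := hd.kernelLE h fun z => min_le_left _ _
  refine ⟨T', hT', _, m, hβ, fun z => min_le_right _ _, hd, hle, ?_⟩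
  refine (norm_kernelOp_sub_le hle ENNReal.ofReal_ne_top fun x => ?_).trans_eq
    (ENNReal.toReal_ofReal hε.le)
  have hs : MeasurableSet {y | (m : ℝ≥0) ≤ α (x, y)} :=
    measurableSet_le measurable_const (measurable_slice hα.1 x)
  rw [h x _ MeasurableSet.univ, hd x _ MeasurableSet.univ, Measure.restrict_univ]
  -- What is lost is at most the integral of α over {α ≥ m}, because α ≤ min(α, m) + α 1_{α ≥ m}.
  refine le_trans ?_ (add_le_add_right ((le_iSup _ x).trans hm) _)
  rw [← lintegral_indicator hs, ← lintegral_add_left (measurable_slice hβ x).coe_nnreal_ennreal]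
  refine lintegral_mono fun y => ?_
  by_cases hy : (m : ℝ≥0) ≤ α (x, y)
  · have : y ∈ {y | (m : ℝ≥0) ≤ α (x, y)} := hy
    rw [Set.indicator_of_mem this]
    exact le_add_self
  · refine le_add_right (ENNReal.coe_le_coe.2 ?_)
    rw [min_eq_left (not_le.1 hy).le]

/-- The essential spectral radius is bounded by the spectral radii of `Q ^ ℓ - T`. -/
theorem essSpecRadius_le_specRadius_sub (Q : Kernel E E) [IsFiniteKernel Q] {ℓ : ℕ} (hℓ : 1 ≤ ℓ)
    {T : Kernel E E} [IsFiniteKernel T] (hT : UnifAC T) (hle : KernelLE T (Q ^ ℓ)) :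
    essSpecRadius (kernelOp Q) ≤ specRadius (kernelOp (Q ^ ℓ) - kernelOp T) ^ (1 / (ℓ : ℝ)) := by
  refine le_of_forall_gt_imp_ge_of_dense fun ρ hρ => ?_
  have hr0 := specRadius_nonneg (kernelOp (Q ^ ℓ) - kernelOp T)
  have hρ0 : 0 < ρ := (Real.rpow_nonneg hr0 _).trans_lt hρ
  have hr : specRadius (kernelOp (Q ^ ℓ) - kernelOp T) < ρ ^ ℓ := by
    have h1 := pow_lt_pow_left₀ hρ (Real.rpow_nonneg hr0 _) (n := ℓ) (by omega)
    rwa [one_div, Real.rpow_inv_natCast_pow hr0 (by omega)] at h1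
  refine essSpecRadius_le_of_hasSplitting hρ0.le ?_
  obtain ⟨ν, α, hν, hα, hd⟩ := hT
  obtain ⟨q, hq1, hq2⟩ := exists_between hr
  have hq0 : 0 < q := hr0.trans_lt hq1
  obtain ⟨n, hn, hn0⟩ := ((eventually_norm_pow_le hq1).and (eventually_gt_atTop 0)).exists
  have hlt : ‖(kernelOp (Q ^ ℓ) - kernelOp T) ^ n‖ < (ρ ^ ℓ) ^ n :=
    hn.trans_lt (pow_lt_pow_left₀ hq2 hq0.le hn0.ne')
  -- The strict bound on this one power survives a small change of T, so T may be replaced by a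
  -- truncation T' while keeping the spectral radius below ρ^ℓ.
  have hcont : Continuous fun S : BddMeas E →L[ℂ] BddMeas E => ‖S ^ n‖ :=
    (continuous_pow n).norm
  obtain ⟨ε, hε, hball⟩ := Metric.eventually_nhds_iff.1
    (hcont.continuousAt.eventually (gt_mem_nhds hlt))
  obtain ⟨T', hT', β, m, hβ, hm, hd', hle', hnorm⟩ :=
    exists_truncation hα (fun x A hA => hd x A hA) (half_pos hε)
  have hle'' : KernelLE T' (Q ^ ℓ) := fun x A hA => (hle' x A hA).trans (hle x A hA)
  have hspec : specRadius (kernelOp (Q ^ ℓ) - kernelOp T') < ρ ^ ℓ := by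
    refine specRadius_lt_of_norm_pow_lt (by positivity) hn0.ne' (hball ?_)
    refine (dist_eq_norm (kernelOp (Q ^ ℓ) - kernelOp T') _).trans_lt ?_
    rw [sub_sub_sub_cancel_left]
    exact hnorm.trans_lt (half_lt_self hε)
  refine hasSplitting_of_eq_add (ℓ := ℓ) (by omega)
    (R := kernelOp (Q ^ ℓ) - kernelOp T') (T := kernelOp T') ?_ (fun i => ?_) hρ0 hspec
  · rw [sub_add_cancel, kernelOp_pow]
  · exact hd'.isCompactOperator_mul_pow_mul hβ hm
      (fun f x => enorm_kernelOp_sub_apply_le hle'' f x) i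

end Truncation

/-! ### From Δ_ν to a kernel of class 𝒦* -/

section AbsolutelyContinuousPart

variable {E : Type*} [MeasurableSpace E]

theorem doeblin_ne_top (ν : Measure E) (K : Kernel E E) [IsFiniteKernel K] : doeblin ν K ≠ ⊤ := by
  refine ne_top_of_le_ne_top (Kernel.bound_ne_top K) ?_
  exact limsup_le_of_le (by isBoundedDefault)
    (Eventually.of_forall fun A => iSup_le fun x => Kernel.measure_le_bound K x A)

theorem exists_forall_measure_lt_of_doeblin_lt {ν : Measure E} {K : Kernel E E} {b : ℝ≥0∞}
    (h : doeblin ν K < b) : ∃ η : ℝ≥0∞, 0 < η ∧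
      ∀ A, MeasurableSet A → ν A < η → ∀ x, K x A ≤ b := by
  have h1 := eventually_lt_of_limsup_lt h (by isBoundedDefault)
  obtain ⟨S, hS, hS'⟩ := (eventually_comap.1 h1).exists_mem
  obtain ⟨η, hη, hηS⟩ := ENNReal.nhds_zero_basis.mem_iff.1 hS
  exact ⟨η, hη, fun A hA hlt x =>
    (le_iSup (fun x => K x A) x).trans (hS' _ (hηS hlt) ⟨A, hA⟩ rfl).le⟩

/-- If `Δ_ν(K) < b`, truncating the density of the absolutely continuous part of `K` gives a kernel
`T ≤ K` of class `𝒦*` with `‖K - T‖ ≤ b`. -/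
theorem exists_unifAC_of_doeblin_lt [MeasurableSpace.CountablyGenerated E] {ν : Measure E}
    [IsProbabilityMeasure ν] {K : Kernel E E} [IsFiniteKernel K] {b : ℝ≥0∞} (hb : b ≠ ⊤)
    (h : doeblin ν K < b) : ∃ (T : Kernel E E) (_ : IsFiniteKernel T), UnifAC T ∧ KernelLE T K ∧
      ‖kernelOp K - kernelOp T‖ ≤ b.toReal := by
  obtain ⟨η, hη, hA⟩ := exists_forall_measure_lt_of_doeblin_lt h
  set κ : Kernel E E := Kernel.const E ν with hκ
  -- With m above `K.bound` / η, Markov's inequality makes the set where the density reaches m have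
  -- ν-measure below η.
  obtain ⟨m, hm⟩ := ENNReal.exists_nat_gt
    (ENNReal.div_ne_top (Kernel.bound_ne_top K) hη.ne')
  have hm0 : (m : ℝ≥0∞) ≠ 0 := (pos_of_gt hm).ne'
  have hrn : Measurable fun z : E × E => Kernel.rnDeriv K κ z.1 z.2 := Kernel.measurable_rnDeriv K κ
  set β : E × E → ℝ≥0 := fun z => (min (Kernel.rnDeriv K κ z.1 z.2) m).toNNReal with hβdef
  have hβ : Measurable β := (hrn.min measurable_const).ennreal_toNNReal
  have hcoe : ∀ z, (β z : ℝ≥0∞) = min (Kernel.rnDeriv K κ z.1 z.2) m := fun z =>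
    ENNReal.coe_toNNReal (ne_top_of_le_ne_top (ENNReal.natCast_ne_top m) (min_le_right _ _))
  have hβm : ∀ z, β z ≤ (m : ℝ≥0) := fun z => by
    rw [← ENNReal.coe_le_coe, hcoe]
    exact min_le_right _ _
  obtain ⟨T, hT, hd⟩ := exists_kernel_hasDensity ν hβ hβm
  have hle : KernelLE T K := by
    intro x A hA
    rw [hd x A hA]
    refine le_trans (lintegral_mono fun y => ?_) (Kernel.setLIntegral_rnDeriv_le (η := κ) hA)
    rw [hcoe]
    exact min_le_left _ _
  refine ⟨T, hT, ⟨ν, β, inferInstance, UnifIntDensity.of_le hβ hβm, hd⟩, hle,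
    norm_kernelOp_sub_le hle hb fun x => ?_⟩
  have hrx : Measurable fun y => Kernel.rnDeriv K κ x y := measurable_slice hrn x
  set S : Set E := {y | (m : ℝ≥0∞) ≤ Kernel.rnDeriv K κ x y} with hSdef
  set N : Set E := Kernel.mutuallySingularSetSlice K κ x with hNdef
  have hS : MeasurableSet S := measurableSet_le measurable_const hrx
  have hN : MeasurableSet N := Kernel.measurableSet_mutuallySingularSetSlice K κ x
  have hνN : ν N = 0 := Kernel.measure_mutuallySingularSetSlice K κ x
  have hνS : ν S < η := by
    have h1 : (m : ℝ≥0∞) * ν S ≤ K.bound := by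
      refine (mul_meas_ge_le_lintegral hrx _).trans ?_
      have h2 := Kernel.setLIntegral_rnDeriv_le (κ := K) (η := κ) (a := x) MeasurableSet.univ
      rw [Measure.restrict_univ] at h2
      exact h2.trans (Kernel.measure_le_bound K x _)
    have h3 : ν S ≤ K.bound / m := by
      rw [ENNReal.le_div_iff_mul_le (Or.inl hm0) (Or.inl (ENNReal.natCast_ne_top m)), mul_comm]
      exact h1
    refine h3.trans_lt ?_
    rw [ENNReal.div_lt_iff (Or.inl hm0) (Or.inl (ENNReal.natCast_ne_top m)), mul_comm]
    rcases eq_or_ne η ⊤ with rfl | hη'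
    · rw [ENNReal.mul_top hm0]
      exact (Kernel.bound_ne_top K).lt_top
    · rwa [ENNReal.div_lt_iff (Or.inl hη.ne') (Or.inl hη')] at hm
  have hνSN : ν (S ∪ N) < η := (measure_union_le S N).trans_lt (by rwa [hνN, add_zero])
  -- Off S ∪ N the measure K x has density below m and is not diminished by truncation; on S ∪ N, of
  -- ν-measure below η, it has mass at most b.
  rw [← measure_add_measure_compl (hS.union hN), add_comm]
  refine add_le_add ?_ (hA _ (hS.union hN) hνSN x)
  have hsub : (S ∪ N)ᶜ ⊆ (Kernel.mutuallySingularSetSlice K κ x)ᶜ :=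
    Set.compl_subset_compl.2 Set.subset_union_right
  rw [← Kernel.withDensity_rnDeriv_of_subset_compl_mutuallySingularSetSlice (κ := K) (η := κ)
    (hS.union hN).compl hsub, Kernel.withDensity_apply' _ hrn]
  refine le_trans ?_ (measure_mono (Set.subset_univ (S ∪ N)ᶜ))
  rw [hd x _ (hS.union hN).compl]
  refine setLIntegral_mono (measurable_slice hβ x).coe_nnreal_ennreal fun y hy => ?_
  rw [hcoe, min_eq_left]
  exact (not_le.1 fun hle => hy (Or.inl hle)).le

end AbsolutelyContinuousPart

/-! ### From a splitting to a bound on Δ_ν -/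

section SplittingToDoeblin

variable {E : Type*} [MeasurableSpace E]

/-- Evaluation at a point as a linear functional. -/
def evalLM (x : E) : BddMeas E →ₗ[ℂ] ℂ where
  toFun f := f x
  map_add' _ _ := rfl
  map_smul' _ _ := rfl

/-- On a finite-dimensional space of functions the norm is controlled by the values at finitely
many points. -/
theorem exists_finset_norm_le (F : Submodule ℂ (BddMeas E)) [FiniteDimensional ℂ F] :
    ∃ (s : Finset E) (C : ℝ), 0 ≤ C ∧ ∀ g ∈ F, ‖g‖ ≤ C * ∑ x ∈ s, ‖g x‖ := by
  let V : Finset E → Submodule ℂ F := fun s => ⨅ x ∈ s, ((evalLM x).comp F.subtype).ker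
  have hV : ∀ s (g : F), g ∈ V s ↔ ∀ x ∈ s, (g : BddMeas E) x = 0 := fun s g => by
    simp only [V, Submodule.mem_iInf, LinearMap.mem_ker]; rfl
  -- V s consists of the functions in F vanishing on s. A minimal V s must be zero, since otherwise
  -- one more point would shrink it.
  obtain ⟨_, ⟨s, rfl⟩, hs⟩ := IsArtinian.set_has_minimal (Set.range V) (Set.range_nonempty V)
  have hbot : ∀ g : F, (∀ x ∈ s, (g : BddMeas E) x = 0) → g = 0 := by
    intro g hg
    by_contra hne
    obtain ⟨x, hx⟩ : ∃ x, (g : BddMeas E) x ≠ 0 := by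
      by_contra! hall
      exact hne (Subtype.ext (BddMeas.ext hall))
    classical
    refine hs (V (insert x s)) ⟨_, rfl⟩ (SetLike.lt_iff_le_and_exists.2 ⟨fun u hu => ?_, g, ?_, ?_⟩)
    · exact (hV _ _).2 fun y hy => (hV _ _).1 hu y (Finset.mem_insert_of_mem hy)
    · exact (hV _ _).2 hg
    · exact fun hmem => hx ((hV _ _).1 hmem x (Finset.mem_insert_self _ _))
  let Λ : F →ₗ[ℂ] (s → ℂ) := LinearMap.pi fun x => (evalLM (x : E)).comp F.subtype
  have hΛ : Λ.ker = ⊥ := by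
    rw [LinearMap.ker_eq_bot']
    exact fun g hg => hbot g fun x hx => congrFun hg ⟨x, hx⟩
  obtain ⟨C, -, hC⟩ := LinearMap.exists_antilipschitzWith Λ hΛ
  refine ⟨s, C, C.2, fun g hg => ?_⟩
  have h1 : ‖(⟨g, hg⟩ : F)‖ ≤ C * ‖Λ ⟨g, hg⟩‖ := by
    have := hC.le_mul_dist ⟨g, hg⟩ 0
    rwa [map_zero, dist_zero_right, dist_zero_right] at this
  refine h1.trans (mul_le_mul_of_nonneg_left ?_ C.2)
  refine (pi_norm_le_iff_of_nonneg (by positivity)).2 fun x => ?_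
  exact Finset.single_le_sum (f := fun x => ‖g x‖) (fun x _ => norm_nonneg _) x.2

theorem norm_kernelOp_indicatorBdd (K : Kernel E E) [IsFiniteKernel K] {A : Set E}
    (hA : MeasurableSet A) (x : E) :
    ‖kernelOp K (indicatorBdd A hA) x‖ = (K x).real A := by
  have h1 : kernelOp K (indicatorBdd A hA) x = ((K x).real A : ℂ) := by
    rw [kernelOp_apply]
    change ∫ y, A.indicator (1 : E → ℂ) y ∂(K x) = _
    rw [integral_indicator hA]
    simp
  rw [h1, Complex.norm_real, Real.norm_of_nonneg measureReal_nonneg]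

/-- If the space splits at `ρ`, then `Q ^ ℓ` is, up to `O(q ^ ℓ)` with `q < ρ`, dominated by its
values at finitely many points. -/
theorem exists_finset_real_le_of_hasSplitting {Q : Kernel E E} [IsFiniteKernel Q] {ρ : ℝ}
    (h : HasSplitting (kernelOp Q) ρ) :
    ∃ (s : Finset E) (C D q : ℝ), 0 ≤ C ∧ 0 < D ∧ 0 < q ∧ q < ρ ∧
      ∀ (ℓ : ℕ) (x : E) (A : Set E), MeasurableSet A →
        ((Q ^ ℓ) x).real A ≤ C * ∑ y ∈ s, ((Q ^ ℓ) y).real A + D * q ^ ℓ := by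
  obtain ⟨F, H, hF, hH, hcompl, hclosed, hspec, hfin, -⟩ := h
  have : CompleteSpace H := hclosed.completeSpace_coe
  obtain ⟨q, hq1, hq2⟩ := exists_between hspec
  have hq0 : 0 < q := (specRadius_nonneg _).trans_lt hq1
  obtain ⟨M, hM0, hM⟩ := exists_norm_pow_le hq1
  obtain ⟨s, C, hC0, hC⟩ := exists_finset_norm_le F
  have htop : Submodule.IsTopCompl H F :=
    Submodule.IsCompl.isTopCompl_of_isClosed hcompl.symm hclosed F.closed_of_finiteDimensional
  set p : BddMeas E →L[ℂ] H := Submodule.projectionOntoL H F htop with hp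
  have hpF : ∀ f, f - p f ∈ F := fun f => by
    rw [← Submodule.projectionOntoL_apply_eq_zero_iff htop, map_sub,
      Submodule.projectionOntoL_apply_left]
    exact sub_self _
  set T := kernelOp Q with hT
  have hTF : ∀ (n : ℕ), ∀ v ∈ F, (T ^ n) v ∈ F := by
    intro n
    induction n with
    | zero => exact fun v hv => hv
    | succ n ih =>
      intro v hv
      rw [pow_succ, mul_apply_eq_comp]
      exact ih _ (hF v hv)
  have hTH : ∀ (n : ℕ) (v : H), ‖(T ^ n) (v : BddMeas E)‖ ≤ M * q ^ n * ‖v‖ := by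
    intro n v
    have hcoe : ∀ (n : ℕ) (v : H), (((T.restrict hH) ^ n) v : BddMeas E) = (T ^ n) v := by
      intro n
      induction n with
      | zero => exact fun v => rfl
      | succ n ih =>
        intro v
        rw [pow_succ, mul_apply_eq_comp, ih, pow_succ, mul_apply_eq_comp]; rfl
    rw [← hcoe, Submodule.norm_coe]
    exact (ContinuousLinearMap.le_opNorm _ _).trans
      (mul_le_mul_of_nonneg_right (hM n) (norm_nonneg _))
  -- F is invariant, so s and C serve every ℓ. The H-part, of size M (‖p‖ + 1) q^ℓ, is paid once at
  -- x and, with weight C, once at each point of s.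
  refine ⟨s, C, (C * s.card + 1) * (M * (‖p‖ + 1)), q, hC0, by positivity, hq0, hq2,
    fun ℓ x A hA => ?_⟩
  set f := indicatorBdd A hA with hf
  set c : ℝ := M * (‖p‖ + 1) * q ^ ℓ with hc
  have hval : ∀ y, ‖(T ^ ℓ) f y‖ = ((Q ^ ℓ) y).real A := fun y => by
    rw [hT, ← kernelOp_pow]
    exact norm_kernelOp_indicatorBdd (Q ^ ℓ) hA y
  have hsmall : ∀ y, ‖(T ^ ℓ) (p f : BddMeas E) y‖ ≤ c := fun y => by
    refine (BddMeas.norm_apply_le _ y).trans ((hTH ℓ (p f)).trans ?_)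
    have h1 : ‖p f‖ ≤ ‖p‖ + 1 := by
      have h2 := p.le_opNorm f
      have h3 := mul_le_mul_of_nonneg_left (norm_indicatorBdd_le hA) (norm_nonneg p)
      rw [hf] at *
      linarith
    calc M * q ^ ℓ * ‖p f‖ ≤ M * q ^ ℓ * (‖p‖ + 1) := by gcongr
      _ = c := by rw [hc]; ring
  have hsplit : ∀ y, (T ^ ℓ) f y = (T ^ ℓ) (f - p f) y + (T ^ ℓ) (p f : BddMeas E) y := fun y => by
    rw [map_sub]
    change _ = ((T ^ ℓ) f y - (T ^ ℓ) (p f : BddMeas E) y) + (T ^ ℓ) (p f : BddMeas E) y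
    rw [sub_add_cancel]
  have hpart : ∀ y, ‖(T ^ ℓ) (f - p f) y‖ ≤ ((Q ^ ℓ) y).real A + c := fun y => by
    rw [← hval, eq_sub_of_add_eq (hsplit y).symm]
    exact (norm_sub_le _ _).trans (add_le_add_right (hsmall y) _)
  have hsum : ∑ y ∈ s, ‖(T ^ ℓ) (f - p f) y‖ ≤ ∑ y ∈ s, ((Q ^ ℓ) y).real A + s.card * c := by
    refine (Finset.sum_le_sum fun y _ => hpart y).trans_eq ?_
    rw [Finset.sum_add_distrib, Finset.sum_const, nsmul_eq_mul]
  rw [← hval, hsplit]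
  calc ‖(T ^ ℓ) (f - p f) x + (T ^ ℓ) (p f : BddMeas E) x‖
      ≤ ‖(T ^ ℓ) (f - p f)‖ + c :=
        (norm_add_le _ _).trans (add_le_add (BddMeas.norm_apply_le _ x) (hsmall x))
    _ ≤ C * ∑ y ∈ s, ‖(T ^ ℓ) (f - p f) y‖ + c :=
        add_le_add_left (hC _ (hTF ℓ _ (hpF f))) _
    _ ≤ C * (∑ y ∈ s, ((Q ^ ℓ) y).real A + s.card * c) + c :=
        add_le_add_left (mul_le_mul_of_nonneg_left hsum hC0) _
    _ = _ := by rw [hc]; ring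

/-- A probability measure with respect to which the sum of finitely many finite measures is
absolutely continuous with bounded density. -/
theorem exists_isProbabilityMeasure_sum_le [Nonempty E] (s : Finset E) (K : Kernel E E)
    [IsFiniteKernel K] : ∃ (ν : Measure E) (M : ℝ), IsProbabilityMeasure ν ∧ 0 ≤ M ∧
      ∀ A, ∑ y ∈ s, (K y).real A ≤ M * ν.real A := by
  obtain ⟨x₀⟩ := ‹Nonempty E›
  -- The Dirac mass makes μ nonzero, hence normalizable, even when s is empty or the measures
  -- vanish.
  set μ : Measure E := (∑ y ∈ s, K y) + Measure.dirac x₀ with hμ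
  have hfin : IsFiniteMeasure μ := inferInstance
  have hne : μ ≠ 0 := fun h0 => by
    have h1 : μ Set.univ = 0 := by rw [h0]; rfl
    simp [hμ] at h1
  have : NeZero μ := ⟨hne⟩
  refine ⟨(μ Set.univ)⁻¹ • μ, μ.real Set.univ, inferInstance, measureReal_nonneg, fun A => ?_⟩
  have h1 : μ.real Set.univ * ((μ Set.univ)⁻¹ • μ).real A = μ.real A := by
    rw [measureReal_ennreal_smul_apply, ENNReal.toReal_inv, ← mul_assoc]
    change μ.real Set.univ * (μ.real Set.univ)⁻¹ * _ = _
    rw [mul_inv_cancel₀ ((measureReal_ne_zero_iff (measure_ne_top μ _)).2 (by simpa using hne)), one_mul]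
  rw [h1, hμ, measureReal_add_apply]
  refine le_trans (le_of_eq ?_) (le_add_of_nonneg_right measureReal_nonneg)
  simp only [Measure.real]
  rw [Measure.finsetSum_apply, ENNReal.toReal_sum fun y _ => measure_ne_top _ _]

theorem doeblin_le_of_real_le {ν : Measure E} [IsProbabilityMeasure ν] {K : Kernel E E}
    [IsFiniteKernel K] {B c : ℝ} (hB : 0 ≤ B) (hc : 0 < c)
    (h : ∀ (x : E) (A : Set E), MeasurableSet A → (K x).real A ≤ B * ν.real A + c) :
    doeblin ν K ≤ ENNReal.ofReal (2 * c) := by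
  refine limsup_le_of_le (by isBoundedDefault) ?_
  -- Below this threshold the term B ν(A) is at most c, which gives the factor 2; B + 1 covers B =
  -- 0.
  have hη : (0 : ℝ≥0∞) < ENNReal.ofReal (c / (B + 1)) := ENNReal.ofReal_pos.2 (by positivity)
  refine (tendsto_comap.eventually (gt_mem_nhds hη)).mono fun A hA => iSup_le fun x => ?_
  have h1 : ν.real A < c / (B + 1) := by
    have := ENNReal.toReal_strict_mono ENNReal.ofReal_ne_top hA
    rwa [ENNReal.toReal_ofReal (by positivity)] at this
  rw [lt_div_iff₀ (by positivity)] at h1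
  rw [ENNReal.le_ofReal_iff_toReal_le (measure_ne_top _ _) (by positivity)]
  have h2 := h x A A.2
  have h3 : 0 ≤ ν.real A := measureReal_nonneg
  change (K x).real A ≤ 2 * c
  nlinarith

/-- Only ν and its normalizing constant depend on ℓ, and they do not enter the bound 2 D q^ℓ, which
is below ρ^ℓ for large ℓ because q < ρ. -/
theorem exists_doeblin_lt_of_hasSplitting [Nonempty E] {Q : Kernel E E} [IsFiniteKernel Q] {ρ : ℝ}
    (h : HasSplitting (kernelOp Q) ρ) : ∃ (ℓ : ℕ) (ν : Measure E), 1 ≤ ℓ ∧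
      IsProbabilityMeasure ν ∧ doeblin ν (Q ^ ℓ) < ENNReal.ofReal (ρ ^ ℓ) := by
  obtain ⟨s, C, D, q, hC, hD, hq0, hqρ, hle⟩ := exists_finset_real_le_of_hasSplitting h
  have hρ : 0 < ρ := hq0.trans hqρ
  have hlim : Tendsto (fun n : ℕ => 2 * D * (q / ρ) ^ n) atTop (𝓝 (2 * D * 0)) :=
    (tendsto_pow_atTop_nhds_zero_of_lt_one (by positivity) ((div_lt_one hρ).2 hqρ)).const_mul _
  rw [mul_zero] at hlim
  obtain ⟨ℓ, hℓ, hℓ1⟩ := ((hlim.eventually (gt_mem_nhds zero_lt_one)).and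
    (eventually_ge_atTop 1)).exists
  obtain ⟨ν, M, hν, hM, hsum⟩ := exists_isProbabilityMeasure_sum_le s (Q ^ ℓ)
  refine ⟨ℓ, ν, hℓ1, hν, ?_⟩
  refine (doeblin_le_of_real_le (B := C * M) (c := D * q ^ ℓ) (by positivity) (by positivity)
    fun x A hA => (hle ℓ x A hA).trans ?_).trans_lt ?_
  · rw [mul_assoc]
    exact add_le_add_left (mul_le_mul_of_nonneg_left (hsum A) hC) _
  · rw [ENNReal.ofReal_lt_ofReal_iff (by positivity)]
    rw [div_pow, ← mul_div_assoc, div_lt_one (by positivity)] at hℓ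
    linarith

end SplittingToDoeblin

/-! ### Comparison of the infima -/

section Comparison

variable {E : Type*} [MeasurableSpace E]

theorem rpow_one_div_le_of_le_pow {a b : ℝ} (ha : 0 ≤ a) (hb : 0 ≤ b) {ℓ : ℕ} (hℓ : 1 ≤ ℓ)
    (h : a ≤ b ^ ℓ) : a ^ (1 / (ℓ : ℝ)) ≤ b := by
  calc a ^ (1 / (ℓ : ℝ)) ≤ (b ^ ℓ) ^ (1 / (ℓ : ℝ)) := by gcongr
    _ = b := by rw [one_div, Real.pow_rpow_inv_natCast hb (by omega)]

theorem essSpecRadius_le_norm_sub (Q : Kernel E E) [IsFiniteKernel Q] {ℓ : ℕ} (hℓ : 1 ≤ ℓ)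
    {T : Kernel E E} [IsFiniteKernel T] (hT : UnifAC T) (hle : KernelLE T (Q ^ ℓ)) :
    essSpecRadius (kernelOp Q) ≤ ‖kernelOp (Q ^ ℓ) - kernelOp T‖ ^ (1 / (ℓ : ℝ)) :=
  (essSpecRadius_le_specRadius_sub Q hℓ hT hle).trans
    (Real.rpow_le_rpow (specRadius_nonneg _) (specRadius_le_norm _) (by positivity))

theorem essSpecRadius_le_doeblin [MeasurableSpace.CountablyGenerated E] (Q : Kernel E E)
    [IsFiniteKernel Q] {ℓ : ℕ} (hℓ : 1 ≤ ℓ) (ν : Measure E) [IsProbabilityMeasure ν] :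
    essSpecRadius (kernelOp Q) ≤ (doeblin ν (Q ^ ℓ)).toReal ^ (1 / (ℓ : ℝ)) := by
  refine le_of_forall_gt_imp_ge_of_dense fun t ht => ?_
  have hD0 : 0 ≤ (doeblin ν (Q ^ ℓ)).toReal := ENNReal.toReal_nonneg
  have ht0 : 0 < t := (Real.rpow_nonneg hD0 _).trans_lt ht
  have h1 := pow_lt_pow_left₀ ht (Real.rpow_nonneg hD0 _) (n := ℓ) (by omega)
  rw [one_div, Real.rpow_inv_natCast_pow hD0 (by omega)] at h1
  obtain ⟨T, hT, hTac, hle, hnorm⟩ := exists_unifAC_of_doeblin_lt (ν := ν) (K := Q ^ ℓ)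
    (b := ENNReal.ofReal (t ^ ℓ)) ENNReal.ofReal_ne_top
    ((ENNReal.lt_ofReal_iff_toReal_lt (doeblin_ne_top _ _)).2 h1)
  rw [ENNReal.toReal_ofReal (by positivity)] at hnorm
  exact (essSpecRadius_le_norm_sub Q hℓ hTac hle).trans
    (rpow_one_div_le_of_le_pow (norm_nonneg _) ht0.le hℓ hnorm)

theorem exists_doeblin_lt_of_essSpecRadius_lt [Nonempty E] {Q : Kernel E E} [IsFiniteKernel Q]
    {b : ℝ} (h : essSpecRadius (kernelOp Q) < b) : ∃ (ℓ : ℕ) (ν : Measure E), 1 ≤ ℓ ∧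
      IsProbabilityMeasure ν ∧ doeblin ν (Q ^ ℓ) < ENNReal.ofReal (b ^ ℓ) := by
  obtain ⟨ρ, hρb, hsplit⟩ := exists_hasSplitting_lt h
  obtain ⟨ℓ, ν, hℓ, hν, hlt⟩ := exists_doeblin_lt_of_hasSplitting hsplit
  refine ⟨ℓ, ν, hℓ, hν, hlt.trans_le (ENNReal.ofReal_le_ofReal ?_)⟩
  -- Monotonicity of the ℓ-th power needs ρ ≥ 0, which the splitting itself forces through r(T|_H) <
  -- ρ.
  obtain ⟨F, H, hF, hH, -, -, hspec, -⟩ := hsplit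
  exact pow_le_pow_left₀ ((specRadius_nonneg _).trans hspec.le) hρb.le ℓ

end Comparison

end KernelQC

end

theorem mainTheorem3 {E : Type*} [MeasurableSpace E] [MeasurableSpace.CountablyGenerated E]
    [Nonempty E] (Q : Kernel E E) [IsFiniteKernel Q] :
    IsGLB {t : ℝ | ∃ (ℓ : ℕ) (ν : Measure E), 1 ≤ ℓ ∧ IsProbabilityMeasure ν ∧
        t = (KernelQC.doeblin ν (Q ^ ℓ)).toReal ^ (1 / (ℓ : ℝ))}
      (KernelQC.essSpecRadius (KernelQC.kernelOp Q)) ∧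
    IsGLB {t : ℝ | ∃ (ℓ : ℕ) (T : Kernel E E) (_ : IsFiniteKernel T), 1 ≤ ℓ ∧
        KernelQC.UnifAC T ∧ KernelQC.KernelLE T (Q ^ ℓ) ∧
        t = ‖KernelQC.kernelOp (Q ^ ℓ) - KernelQC.kernelOp T‖ ^ (1 / (ℓ : ℝ))}
      (KernelQC.essSpecRadius (KernelQC.kernelOp Q)) ∧
    IsGLB {t : ℝ | ∃ (ℓ : ℕ) (T : Kernel E E) (_ : IsFiniteKernel T), 1 ≤ ℓ ∧
        KernelQC.UnifAC T ∧ KernelQC.KernelLE T (Q ^ ℓ) ∧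
        t = KernelQC.specRadius
          (KernelQC.kernelOp (Q ^ ℓ) - KernelQC.kernelOp T) ^ (1 / (ℓ : ℝ))}
      (KernelQC.essSpecRadius (KernelQC.kernelOp Q)) := by
  -- One kernel serves both the norm and the spectral radius infimum, since r ≤ ‖·‖.
  have hT : ∀ b : ℝ, KernelQC.essSpecRadius (KernelQC.kernelOp Q) < b →
      ∃ (ℓ : ℕ) (T : Kernel E E) (_ : IsFiniteKernel T), 1 ≤ ℓ ∧ KernelQC.UnifAC T ∧
        KernelQC.KernelLE T (Q ^ ℓ) ∧
        ‖KernelQC.kernelOp (Q ^ ℓ) - KernelQC.kernelOp T‖ ≤ b ^ ℓ := by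
    intro b hb
    have hb0 : 0 ≤ b := (KernelQC.essSpecRadius_nonneg _).trans hb.le
    obtain ⟨ℓ, ν, hℓ, hν, hlt⟩ := KernelQC.exists_doeblin_lt_of_essSpecRadius_lt hb
    obtain ⟨T, hT, hac, hle, hnorm⟩ :=
      KernelQC.exists_unifAC_of_doeblin_lt ENNReal.ofReal_ne_top hlt
    rw [ENNReal.toReal_ofReal (by positivity)] at hnorm
    exact ⟨ℓ, T, hT, hℓ, hac, hle, hnorm⟩
  refine ⟨⟨?_, fun c hc => ?_⟩, ⟨?_, fun c hc => ?_⟩, ⟨?_, fun c hc => ?_⟩⟩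
  · rintro t ⟨ℓ, ν, hℓ, hν, rfl⟩
    exact KernelQC.essSpecRadius_le_doeblin Q hℓ ν
  · refine le_of_forall_gt_imp_ge_of_dense fun b hb => ?_
    have hb0 : 0 ≤ b := (KernelQC.essSpecRadius_nonneg _).trans hb.le
    obtain ⟨ℓ, ν, hℓ, hν, hlt⟩ := KernelQC.exists_doeblin_lt_of_essSpecRadius_lt hb
    refine (hc ⟨ℓ, ν, hℓ, hν, rfl⟩).trans
      (KernelQC.rpow_one_div_le_of_le_pow ENNReal.toReal_nonneg hb0 hℓ ?_)
    exact ENNReal.toReal_le_of_le_ofReal (by positivity) hlt.le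
  · rintro t ⟨ℓ, T, hfin, hℓ, hac, hle, rfl⟩
    exact KernelQC.essSpecRadius_le_norm_sub Q hℓ hac hle
  · refine le_of_forall_gt_imp_ge_of_dense fun b hb => ?_
    have hb0 : 0 ≤ b := (KernelQC.essSpecRadius_nonneg _).trans hb.le
    obtain ⟨ℓ, T, hfin, hℓ, hac, hle, hnorm⟩ := hT b hb
    exact (hc ⟨ℓ, T, hfin, hℓ, hac, hle, rfl⟩).trans
      (KernelQC.rpow_one_div_le_of_le_pow (norm_nonneg _) hb0 hℓ hnorm)
  · rintro t ⟨ℓ, T, hfin, hℓ, hac, hle, rfl⟩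
    exact KernelQC.essSpecRadius_le_specRadius_sub Q hℓ hac hle
  · refine le_of_forall_gt_imp_ge_of_dense fun b hb => ?_
    have hb0 : 0 ≤ b := (KernelQC.essSpecRadius_nonneg _).trans hb.le
    obtain ⟨ℓ, T, hfin, hℓ, hac, hle, hnorm⟩ := hT b hb
    exact (hc ⟨ℓ, T, hfin, hℓ, hac, hle, rfl⟩).trans
      (KernelQC.rpow_one_div_le_of_le_pow (KernelQC.specRadius_nonneg _) hb0 hℓ
        ((KernelQC.specRadius_le_norm _).trans hnorm))
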